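/- Let $1<\alpha<2$ and let $(\widehat Z,Z)$ be $(\mathbb R,\mathbb R)$ (the non-periodic setting) or $(\mathbb T,\mathbb Z)$ with $\mathbb T=\mathbb R/2\pi\mathbb Z$ (the periodic setting), where $\mathbb R$ carries Lebesgue measure and $\mathbb Z$ counting measure. Write $\langle a\rangle=1+|a|$, and for $s,b\in\mathbb R$ let $$X^{s,b}_{\widehat Z}=\Big\{u\in\mathcal S'(\mathbb R\times\widehat Z):\ \|u\|_{X^{s,b}_{\widehat Z}}:=\big\|\langle\xi\rangle^{s}\,\langle\tau-|\xi|^{\alpha}\rangle^{b}\,\widehat u(\tau,\xi)\big\|_{L^2(\mathbb R\times Z)}<\infty\Big\},$$ where $\widehat u(\tau,\xi)=\int_{\mathbb R}\int_{\widehat Z}e^{-i(t\tau+x\xi)}u(t,x)\,dx\,dt$ (in the sense of tempered distributions) is the Fourier transform in time and space. There is $\varepsilon_0>0$, depending only on $\alpha$, such that for every $0<\varepsilon<\varepsilon_0$, every $s\ge\frac{2-\alpha}4$ and both settings there is a constant $C<\infty$, depending only on $\alpha$, $s$, $\varepsilon$ and the setting, such that the following holds. All $u\in X^{0,\frac12-\varepsilon}_{\widehat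 Z}$ and $v\in X^{s,\frac12+\varepsilon}_{\widehat Z}$ are functions in $L^2(\mathbb R\times\widehat Z)$, and $$\|uv\|_{L^2(\mathbb R\times\widehat Z)}=\|u\overline v\|_{L^2(\mathbb R\times\widehat Z)}\le C\,\|u\|_{X^{0,\frac12-\varepsilon}_{\widehat Z}}\,\|v\|_{X^{s,\frac12+\varepsilon}_{\widehat Z}}.$$ -/

import Mathlib

open MeasureTheory
open scoped ENNReal NNReal SchwartzMap FourierTransform ComplexConjugate

noncomputable section

namespace FracNLS

/-- The circle of length `2π`. -/
abbrev Circ : Type := AddCircle (2 * Real.pi)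

instance factTwoPi : Fact (0 < 2 * Real.pi) := ⟨Real.two_pi_pos⟩

/-- The bracket `⟨a⟩ = 1 + |a|`. -/
def bracket (a : ℝ) : ℝ := 1 + |a|

/-- The weight `⟨ξ⟩ ^ s ⟨τ - |ξ| ^ α⟩ ^ b` at the frequency `(τ, ξ)`. -/
def weight (α s b τ ξ : ℝ) : ℝ := bracket ξ ^ s * bracket (τ - |ξ| ^ α) ^ b

/-- Multiplication by `(2π)⁻¹`, followed by the identification of `ℝ × ℝ` (with its product topology)
with the Euclidean plane. -/
def toPlane : (ℝ × ℝ) ≃L[ℝ] WithLp 2 (ℝ × ℝ) :=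
  (ContinuousLinearEquiv.smulLeft (Units.mk0 (2 * Real.pi)⁻¹ (inv_ne_zero Real.two_pi_pos.ne'))).trans
    (WithLp.prodContinuousLinearEquiv 2 ℝ ℝ ℝ).symm

/-- The Fourier transform in the normalization `φ̂ (t, x) = ∫∫ exp (-i (t τ + x ξ)) φ (τ, ξ) dτ dξ`,
as a map of the Schwartz space of `ℝ × ℝ` to itself; see `fourierS_apply`. -/
def fourierS (φ : 𝓢(ℝ × ℝ, ℂ)) : 𝓢(ℝ × ℝ, ℂ) :=
  SchwartzMap.compCLMOfContinuousLinearEquiv ℂ toPlane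
    (𝓕 (SchwartzMap.compCLMOfContinuousLinearEquiv ℂ
      (WithLp.prodContinuousLinearEquiv 2 ℝ ℝ ℝ) φ))

theorem fourierS_apply (φ : 𝓢(ℝ × ℝ, ℂ)) (z : ℝ × ℝ) :
    fourierS φ z =
      ∫ ζ : ℝ × ℝ, Complex.exp (-Complex.I * ((z.1 * ζ.1 + z.2 * ζ.2 : ℝ) : ℂ)) * φ ζ := by
  have h : fourierS φ z = 𝓕 (fun w : WithLp 2 (ℝ × ℝ) => φ (WithLp.ofLp w)) (toPlane z) := rfl
  rw [h, Real.fourier_eq, ← (WithLp.volume_preserving_toLp (U := ℝ) (V := ℝ)).integral_comp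
    (MeasurableEquiv.toLp 2 (ℝ × ℝ)).measurableEmbedding]
  refine integral_congr_ae (Filter.Eventually.of_forall fun ζ => ?_)
  have h1 : (toPlane z) = WithLp.toLp 2 ((2 * Real.pi)⁻¹ * z.1, (2 * Real.pi)⁻¹ * z.2) := rfl
  simp only [h1, WithLp.prod_inner_apply, Circle.smul_def, Real.fourierChar_apply, smul_eq_mul]
  congr 2
  have hpi : (Real.pi : ℂ) ≠ 0 := by exact_mod_cast Real.pi_ne_zero
  simp
  field_simp
  ring

/-! ### The non-periodic setting: distributions on `ℝ × ℝ`, in the variables `(t, x)` -/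

/-- The Fourier transform of the tempered distribution `u` is the function `U`, that is
`⟨u, φ̂⟩ = ∫∫ U (τ, ξ) φ (τ, ξ) dτ dξ` for all Schwartz functions `φ`. Such a function `U` is unique
up to equality almost everywhere. -/
def HasFourierLine (u : 𝓢'(ℝ × ℝ, ℂ)) (U : ℝ × ℝ → ℂ) : Prop :=
  AEStronglyMeasurable U volume ∧
    ∀ φ : 𝓢(ℝ × ℝ, ℂ), Integrable (fun p => U p * φ p) volume ∧
      u (fourierS φ) = ∫ p, U p * φ p

/-- The norm of `X^{s,b}(ℝ × ℝ)`: the `L²(ℝ × ℝ)` norm of `⟨ξ⟩ ^ s ⟨τ - |ξ| ^ α⟩ ^ b û (τ, ξ)`,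
and `∞` if `û` is not a function. The infimum is over the versions of the function `û`, all of which
give the same value. -/
def normXLine (α s b : ℝ) (u : 𝓢'(ℝ × ℝ, ℂ)) : ℝ≥0∞ :=
  ⨅ (U : ℝ × ℝ → ℂ) (_ : HasFourierLine u U),
    eLpNorm (fun p => (weight α s b p.1 p.2 : ℂ) * U p) 2 volume

/-- The space `X^{s,b}(ℝ × ℝ)`. -/
def XLine (α s b : ℝ) : Set 𝓢'(ℝ × ℝ, ℂ) := {u | normXLine α s b u < ∞}

/-- The tempered distribution `u` is (integration against) the function `f ∈ L²(ℝ × ℝ)`. -/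
def IsFunLine (u : 𝓢'(ℝ × ℝ, ℂ)) (f : ℝ × ℝ → ℂ) : Prop :=
  MemLp f 2 volume ∧ ∀ φ : 𝓢(ℝ × ℝ, ℂ), u φ = ∫ p, f p * φ p

/-! ### The periodic setting: distributions on `ℝ × 𝕋`, where `𝕋 = ℝ / 2πℤ`

A tempered distribution on `ℝ × 𝕋` is a tempered distribution `u` on `ℝ × ℝ` that is `2π`-periodic
in the second variable. If `U k` is the Fourier transform in time of its `k`-th Fourier coefficient
`∫_𝕋 exp (-i x k) u (·, x) dx`, then the Fourier transform of `u` on `ℝ × ℝ` is `∑ k, U k ⊗ δ_k`. -/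

/-- `u` is invariant under the translation by `2π` in the second variable. -/
def IsPeriodic (u : 𝓢'(ℝ × ℝ, ℂ)) : Prop :=
  ∀ φ : 𝓢(ℝ × ℝ, ℂ), u (φ.compSubConstCLM ℂ ((0 : ℝ), 2 * Real.pi)) = u φ

/-- The product of Lebesgue measure on `ℝ` and counting measure on `ℤ`. -/
def freqMeasure : Measure (ℝ × ℤ) := (volume : Measure ℝ).prod Measure.count

/-- The Fourier transform of the tempered distribution `u` on `ℝ × 𝕋` is the function `U` on
`ℝ × ℤ`, that is `⟨u, φ̂⟩ = ∑ k, ∫ U (τ, k) φ (τ, k) dτ` for all Schwartz functions `φ` on `ℝ × ℝ`.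
Such a function `U` is unique up to equality almost everywhere. -/
def HasFourierTorus (u : 𝓢'(ℝ × ℝ, ℂ)) (U : ℝ × ℤ → ℂ) : Prop :=
  AEStronglyMeasurable U freqMeasure ∧
    ∀ φ : 𝓢(ℝ × ℝ, ℂ), Integrable (fun p : ℝ × ℤ => U p * φ (p.1, (p.2 : ℝ))) freqMeasure ∧
      u (fourierS φ) = ∫ p : ℝ × ℤ, U p * φ (p.1, (p.2 : ℝ)) ∂freqMeasure

/-- The norm of `X^{s,b}(ℝ × 𝕋)`: the `L²(ℝ × ℤ)` norm of `⟨k⟩ ^ s ⟨τ - |k| ^ α⟩ ^ b û (τ, k)`, and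
`∞` if `û` is not a function. The infimum is over the versions of the function `û`, all of which
give the same value. -/
def normXTorus (α s b : ℝ) (u : 𝓢'(ℝ × ℝ, ℂ)) : ℝ≥0∞ :=
  ⨅ (U : ℝ × ℤ → ℂ) (_ : HasFourierTorus u U),
    eLpNorm (fun p : ℝ × ℤ => (weight α s b p.1 (p.2 : ℝ) : ℂ) * U p) 2 freqMeasure

/-- The space `X^{s,b}(ℝ × 𝕋)`. -/
def XTorus (α s b : ℝ) : Set 𝓢'(ℝ × ℝ, ℂ) := {u | IsPeriodic u ∧ normXTorus α s b u < ∞}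

/-- The tempered distribution `u` on `ℝ × 𝕋` is the function `f ∈ L²(ℝ × 𝕋)`: as a distribution on
`ℝ × ℝ`, it is integration against the periodic extension of `f`. -/
def IsFunTorus (u : 𝓢'(ℝ × ℝ, ℂ)) (f : ℝ × Circ → ℂ) : Prop :=
  MemLp f 2 volume ∧ ∀ φ : 𝓢(ℝ × ℝ, ℂ), u φ = ∫ p : ℝ × ℝ, f (p.1, (p.2 : Circ)) * φ p

end FracNLS

end

noncomputable section

namespace FracNLS

/-! ### Brackets -/

/-! Conjugating v does not change |v|, so only uv matters. On the Fourier side uv is a convolution.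
Inserting the two weights and applying Cauchy–Schwarz (`lintegral_conv_sq_le`) reduces the estimate
to a bound, uniform in the output frequency (τ, ξ), for the integral of the reciprocal squared
weights (`exists_lintegral_weight_le`). The squared modulation weights have exponents p = 1 - 2ε and
q = 1 + 2ε. The two modulations add up to τ - `phase α ξ η`, which is free of the time frequency
being integrated. Since q > 1, the time integral can be carried out, and what remains is the
integral of ⟨η⟩^(-2s) ⟨τ - phase⟩^(-p) in η.

That integral is bounded (`lintegral_kernel_le`) by the geometry of the phase |η|^α + |ξ - η|^α,
where ξ ≥ 0 by symmetry. For |η| ≤ ξ/4 the phase has slope bounded below (if ξ ≥ 1), and ⟨η⟩^(-(1 -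
α/2)) supplies the decay that p < 1 lacks. For |η| ≥ ξ/4 the stationary point ξ/2 may be close. The
curvature there is of order l² with l = ⟨ξ⟩^(-(1 - α/2)), so the phase stays near a given value on a
set of length up to about 1/l. The weight is O(l) and compensates exactly, which is why s ≥ (2 -
α)/4 suffices. For displacements beyond ⟨ξ⟩ the phase grows like the power α, and αp > 1. Level sets
are never solved for: an almost closest point to the level τ replaces the roots
(`exists_bracket_sub_le`). All majorants are then translated brackets, and the frequency measure
enters only through `BracketBound`, which holds for Lebesgue and for counting measure.

The passage to distributions is also common to both settings. `IsBesselKernel` abstracts Plancherel,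
and `IsCover` the projection from the line to the line or the circle. Truncations define the
transform on L², Fatou's lemma carries the bilinear bound to the limit, and Fourier inversion on
test functions identifies the transform with the given distribution. -/

theorem one_le_bracket (x : ℝ) : 1 ≤ bracket x := by
  unfold bracket; linarith [abs_nonneg x]

theorem bracket_pos (x : ℝ) : 0 < bracket x := zero_lt_one.trans_le (one_le_bracket x)

theorem bracket_neg (x : ℝ) : bracket (-x) = bracket x := by simp [bracket]

theorem continuous_bracket : Continuous bracket := by unfold bracket; fun_prop

@[fun_prop]
theorem measurable_bracket : Measurable bracket := continuous_bracket.measurable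

/-- If `A ≤ C B` for positive quantities, then `B ^ (-p) ≤ C ^ p A ^ (-p)`. -/
theorem rpow_neg_le_of_le_mul {A B C p : ℝ} (hA : 0 < A) (hB : 0 < B) (hC : 0 < C) (hp : 0 ≤ p)
    (h : A ≤ C * B) : B ^ (-p) ≤ C ^ p * A ^ (-p) := by
  have h1 : (C * B) ^ (-p) ≤ A ^ (-p) :=
    Real.rpow_le_rpow_of_nonpos hA h (neg_nonpos.2 hp)
  rw [Real.mul_rpow hC.le hB.le] at h1
  calc B ^ (-p) = C ^ p * (C ^ (-p) * B ^ (-p)) := by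
        rw [← mul_assoc, ← Real.rpow_add hC]; simp
    _ ≤ C ^ p * A ^ (-p) := by gcongr

/-- Replacing the larger bracket by the smaller one only increases a negative power, so the two
decay rates add up. -/
theorem bracket_rpow_neg_mul_le {a b : ℝ} (ha : 0 ≤ a) (hb : 0 ≤ b) (x y : ℝ) :
    bracket x ^ (-a) * bracket y ^ (-b) ≤ bracket x ^ (-(a + b)) + bracket y ^ (-(a + b)) := by
  have hx := bracket_pos x
  have hy := bracket_pos y
  rcases le_total (bracket x) (bracket y) with h | h
  · calc _ ≤ bracket x ^ (-a) * bracket x ^ (-b) := by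
          gcongr ?_ * ?_
          exact Real.rpow_le_rpow_of_nonpos hx h (neg_nonpos.2 hb)
      _ = bracket x ^ (-(a + b)) := by rw [← Real.rpow_add hx]; ring_nf
      _ ≤ _ := le_add_of_nonneg_right (by positivity)
  · calc _ ≤ bracket y ^ (-a) * bracket y ^ (-b) := by
          gcongr ?_ * ?_
          exact Real.rpow_le_rpow_of_nonpos hy h (neg_nonpos.2 ha)
      _ = bracket y ^ (-(a + b)) := by rw [← Real.rpow_add hy]; ring_nf
      _ ≤ _ := le_add_of_nonneg_left (by positivity)

/-- The larger of the two brackets is at least half of ⟨x + y⟩ and pays for the factor with exponent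
-p. If it carries the exponent -q, the surplus q - p is handed to the smaller bracket. -/
theorem bracket_mul_bracket_rpow_neg_le {p q : ℝ} (hp : 0 ≤ p) (hpq : p ≤ q) (x y : ℝ) :
    bracket x ^ (-p) * bracket y ^ (-q) ≤
      2 ^ p * bracket (x + y) ^ (-p) * (bracket x ^ (-q) + bracket y ^ (-q)) := by
  have hx := bracket_pos x
  have hy := bracket_pos y
  have hxy := bracket_pos (x + y)
  have hsum : bracket (x + y) ≤ bracket x + bracket y := by
    unfold bracket; linarith [abs_add_le x y]
  rcases le_total (bracket x) (bracket y) with h | h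
  · have h1 : bracket y ^ (-p) ≤ 2 ^ p * bracket (x + y) ^ (-p) :=
      rpow_neg_le_of_le_mul hxy hy two_pos hp (by linarith)
    have h2 : bracket y ^ (-(q - p)) ≤ bracket x ^ (-(q - p)) :=
      Real.rpow_le_rpow_of_nonpos hx h (by linarith)
    calc _ = bracket y ^ (-p) * (bracket x ^ (-p) * bracket y ^ (-(q - p))) := by
          rw [mul_left_comm, ← Real.rpow_add hy]; ring_nf
      _ ≤ (2 ^ p * bracket (x + y) ^ (-p)) * (bracket x ^ (-p) * bracket x ^ (-(q - p))) := by
          gcongr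
      _ = (2 ^ p * bracket (x + y) ^ (-p)) * bracket x ^ (-q) := by
          rw [← Real.rpow_add hx]; ring_nf
      _ ≤ _ := by
          gcongr
          exact le_add_of_nonneg_right (by positivity)
  · have h1 : bracket x ^ (-p) ≤ 2 ^ p * bracket (x + y) ^ (-p) :=
      rpow_neg_le_of_le_mul hxy hx two_pos hp (by linarith)
    calc _ ≤ (2 ^ p * bracket (x + y) ^ (-p)) * bracket y ^ (-q) := by gcongr
      _ ≤ _ := by
          gcongr
          exact le_add_of_nonneg_left (by positivity)

/-- On a nonempty set there is a point which almost minimizes the distance of `h` to `τ`; the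
values of `h` at the other points are at least as far from `τ` as from the value there. -/
theorem exists_bracket_sub_le {S : Set ℝ} (hS : S.Nonempty) (h : ℝ → ℝ) (τ : ℝ) :
    ∃ a ∈ S, ∀ η ∈ S, bracket (h η - h a) ≤ 3 * bracket (τ - h η) := by
  have : Nonempty S := hS.to_subtype
  set m : ℝ := ⨅ η : S, bracket (τ - h η)
  have hbdd : BddBelow (Set.range fun η : S => bracket (τ - h η)) :=
    ⟨0, by rintro _ ⟨η, rfl⟩; exact (bracket_pos _).le⟩
  have hm : 1 ≤ m := le_ciInf fun η => one_le_bracket _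
  -- The infimum need not be attained; a factor 2 of slack is available because m ≥ 1, and it gives
  -- the constant 3 = 2 + 1.
  obtain ⟨⟨a, ha⟩, ham⟩ := exists_lt_of_ciInf_lt (show m < 2 * m by linarith)
  refine ⟨a, ha, fun η hη => ?_⟩
  have h1 : m ≤ bracket (τ - h η) := ciInf_le hbdd ⟨η, hη⟩
  have h2 : bracket (h η - h a) ≤ bracket (τ - h a) + bracket (τ - h η) := by
    unfold bracket
    have := abs_sub (τ - h a) (τ - h η)
    rw [show τ - h a - (τ - h η) = h η - h a by ring] at this
    linarith
  simp only at ham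
  linarith

/-! ### The phase function -/

/-- The odd power `|x| ^ (α - 2) x`, whose primitive is `|x| ^ α / α`. -/
def oddPow (α x : ℝ) : ℝ := |x| ^ (α - 2) * x

theorem oddPow_neg (α x : ℝ) : oddPow α (-x) = -oddPow α x := by simp [oddPow]

theorem oddPow_of_nonneg {α x : ℝ} (hα : 1 < α) (hx : 0 ≤ x) : oddPow α x = x ^ (α - 1) := by
  rcases hx.eq_or_lt with rfl | hx
  · rw [oddPow, Real.zero_rpow (by linarith)]; simp
  · rw [oddPow, abs_of_pos hx, show α - 1 = α - 2 + 1 by ring, Real.rpow_add_one hx.ne']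

theorem oddPow_mono {α : ℝ} (hα : 1 < α) : Monotone (oddPow α) := by
  have key : ∀ x y : ℝ, 0 ≤ x → x ≤ y → oddPow α x ≤ oddPow α y := fun x y hx hxy => by
    rw [oddPow_of_nonneg hα hx, oddPow_of_nonneg hα (hx.trans hxy)]
    exact Real.rpow_le_rpow hx hxy (by linarith)
  have hsign : ∀ x : ℝ, x ≤ 0 → oddPow α x ≤ 0 := fun x hx =>
    mul_nonpos_of_nonneg_of_nonpos (by positivity) hx
  intro x y hxy
  rcases le_total 0 x with hx | hx
  · exact key x y hx hxy
  · rcases le_total 0 y with hy | hy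
    · exact (hsign x hx).trans (mul_nonneg (by positivity) hy)
    · have := key (-y) (-x) (by linarith) (by linarith)
      rw [oddPow_neg, oddPow_neg] at this
      linarith

/-- Concavity of x^(α - 1) on the half-line: the tangent at m + t lies above the graph, and
Bernoulli's inequality bounds the increment from m to m + t. Giving up the increment from m - t to m
avoids a case distinction on the sign of m - t. -/
theorem le_oddPow_sub_oddPow {α : ℝ} (hα₁ : 1 < α) (hα₂ : α < 2) {m t : ℝ} (hm : 0 ≤ m)
    (ht : 0 ≤ t) :
    (α - 1) * t * (m + t) ^ (α - 2) ≤ oddPow α (m + t) - oddPow α (m - t) := by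
  rcases (add_nonneg hm ht).eq_or_lt with h0 | hpos
  · have : t = 0 := by linarith
    simp [this]
  have h1 : oddPow α (m - t) ≤ m ^ (α - 1) := by
    rw [← oddPow_of_nonneg hα₁ hm]; exact oddPow_mono hα₁ (by linarith)
  have h2 : m ^ (α - 1) ≤ (m + t) ^ (α - 1) * (1 + (α - 1) * (-(t / (m + t)))) := by
    have hle : t / (m + t) ≤ 1 := (div_le_one hpos).2 (by linarith)
    have := rpow_one_add_le_one_add_mul_self (s := -(t / (m + t))) (p := α - 1)
      (by linarith) (by linarith) (by linarith)
    calc m ^ (α - 1) = ((m + t) * (1 + -(t / (m + t)))) ^ (α - 1) := by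
          congr 1; field_simp; ring
      _ = (m + t) ^ (α - 1) * (1 + -(t / (m + t))) ^ (α - 1) :=
          Real.mul_rpow hpos.le (by linarith)
      _ ≤ _ := by gcongr
  have h3 : (m + t) ^ (α - 1) = (m + t) ^ (α - 2) * (m + t) := by
    rw [← Real.rpow_add_one hpos.ne']; ring_nf
  have h4 : (m + t) ^ (α - 1) * (1 + (α - 1) * (-(t / (m + t)))) =
      (m + t) ^ (α - 1) - (α - 1) * t * (m + t) ^ (α - 2) := by
    rw [h3]; field_simp; ring
  rw [oddPow_of_nonneg hα₁ hpos.le]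
  linarith

/-- The phase `|η| ^ α + |ξ - η| ^ α` of an interaction with total frequency `ξ`. -/
def phase (α ξ η : ℝ) : ℝ := |η| ^ α + |ξ - η| ^ α

theorem phase_reflect (α ξ η : ℝ) : phase α ξ (ξ - η) = phase α ξ η := by
  simp [phase, add_comm]

theorem phase_neg (α ξ η : ℝ) : phase α (-ξ) (-η) = phase α ξ η := by
  unfold phase
  rw [abs_neg, show -ξ - -η = -(ξ - η) by ring, abs_neg]

theorem hasDerivAt_phase {α : ℝ} (hα : 1 < α) (ξ η : ℝ) :
    HasDerivAt (phase α ξ) (α * (oddPow α η - oddPow α (ξ - η))) η := by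
  have h1 := hasDerivAt_abs_rpow η hα
  have h2 := (hasDerivAt_abs_rpow (ξ - η) hα).comp η ((hasDerivAt_id η).const_sub ξ)
  convert! h1.add h2 using 1
  simp only [oddPow]
  ring

/-- To the right of its centre the phase grows at least quadratically, with the curvature it has at
the largest scale involved. -/
theorem le_phase_sub_phase {α : ℝ} (hα₁ : 1 < α) (hα₂ : α < 2) {ξ a d : ℝ} (hξ : 0 ≤ ξ)
    (ha : ξ / 2 ≤ a) (hd : 0 ≤ d) :
    α * (α - 1) / 2 * d ^ 2 * (ξ + d) ^ (α - 2) ≤ phase α ξ (a + d) - phase α ξ a := by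
  rcases hd.eq_or_lt with rfl | hd
  · simp
  set κ : ℝ := α * (α - 1) / 2 * (ξ + d) ^ (α - 2) with hκ
  have hE : ∀ t : ℝ, HasDerivAt (fun t => phase α ξ (a + t) - κ * t ^ 2)
      (α * (oddPow α (a + t) - oddPow α (ξ - (a + t))) - κ * (2 * t)) t := fun t => by
    have h1 := (hasDerivAt_phase hα₁ ξ (a + t)).comp t ((hasDerivAt_id t).const_add a)
    have h2 := ((hasDerivAt_id t).pow 2).const_mul κ
    convert! h1.sub h2 using 1
    simp
  -- Comparison with a parabola. Monotonicity of `oddPow` moves the derivative bound from the base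
  -- point a back to the centre ξ/2, and (ξ + d)^(α - 2) bounds the curvature factor from below on
  -- the whole interval.
  have hmono : MonotoneOn (fun t => phase α ξ (a + t) - κ * t ^ 2) (Set.Icc 0 d) := by
    refine monotoneOn_of_deriv_nonneg (convex_Icc 0 d)
      (fun t _ => (hE t).continuousAt.continuousWithinAt)
      (fun t _ => (hE t).differentiableAt.differentiableWithinAt) fun t ht => ?_
    rw [interior_Icc] at ht
    rw [(hE t).deriv]
    have h1 := le_oddPow_sub_oddPow hα₁ hα₂ (m := ξ / 2) (t := t) (by linarith) ht.1.le
    have h2 : oddPow α (ξ / 2 + t) ≤ oddPow α (a + t) := oddPow_mono hα₁ (by linarith)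
    have h3 : oddPow α (ξ - (a + t)) ≤ oddPow α (ξ / 2 - t) := oddPow_mono hα₁ (by linarith)
    have h4 : (ξ + d) ^ (α - 2) ≤ (ξ / 2 + t) ^ (α - 2) :=
      Real.rpow_le_rpow_of_nonpos (by linarith [ht.1]) (by linarith [ht.2]) (by linarith)
    have h5 : (α - 1) * t * (ξ + d) ^ (α - 2) ≤ (α - 1) * t * (ξ / 2 + t) ^ (α - 2) :=
      mul_le_mul_of_nonneg_left h4 (mul_nonneg (by linarith) ht.1.le)
    have h6 : κ * (2 * t) = α * ((α - 1) * t * (ξ + d) ^ (α - 2)) := by rw [hκ]; ring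
    rw [h6, ← mul_sub]
    exact mul_nonneg (by linarith) (by linarith)
  have := hmono (Set.left_mem_Icc.2 hd.le) (Set.right_mem_Icc.2 hd.le) hd.le
  simp only [add_zero] at this
  calc _ = κ * d ^ 2 := by rw [hκ]; ring
    _ ≤ _ := by linarith

theorem le_abs_phase_sub_phase_right {α : ℝ} (hα₁ : 1 < α) (hα₂ : α < 2) {ξ a η : ℝ} (hξ : 0 ≤ ξ)
    (ha : ξ / 2 ≤ a) (hη : ξ / 2 ≤ η) :
    α * (α - 1) / 2 * |η - a| ^ 2 * (ξ + |η - a|) ^ (α - 2) ≤ |phase α ξ η - phase α ξ a| := by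
  wlog h : a ≤ η generalizing a η
  · have := this hη ha (le_of_not_ge h)
    rwa [abs_sub_comm a η, abs_sub_comm (phase α ξ a)] at this
  have := le_phase_sub_phase hα₁ hα₂ hξ ha (sub_nonneg.2 h)
  rw [add_sub_cancel, ← abs_of_nonneg (sub_nonneg.2 h)] at this
  exact this.trans (le_abs_self _)

theorem le_abs_phase_sub_phase_left {α : ℝ} (hα₁ : 1 < α) (hα₂ : α < 2) {ξ a η : ℝ} (hξ : 0 ≤ ξ)
    (ha : a ≤ ξ / 2) (hη : η ≤ ξ / 2) :
    α * (α - 1) / 2 * |η - a| ^ 2 * (ξ + |η - a|) ^ (α - 2) ≤ |phase α ξ η - phase α ξ a| := by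
  have := le_abs_phase_sub_phase_right hα₁ hα₂ hξ (a := ξ - a) (η := ξ - η) (by linarith)
    (by linarith)
  rwa [phase_reflect, phase_reflect, show ξ - η - (ξ - a) = -(η - a) by ring, abs_neg] at this

/-- Away from its centre the phase has no stationary point. -/
theorem le_abs_phase_sub_phase_near_zero {α : ℝ} (hα₁ : 1 < α) (hα₂ : α < 2) {ξ a η : ℝ}
    (hξ : 1 ≤ ξ) (ha : |a| ≤ ξ / 4) (hη : |η| ≤ ξ / 4) :
    α * (α - 1) / 8 * |η - a| ≤ |phase α ξ η - phase α ξ a| := by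
  wlog h : a ≤ η generalizing a η
  · have := this hη ha (le_of_not_ge h)
    rwa [abs_sub_comm a η, abs_sub_comm (phase α ξ a)] at this
  rw [abs_of_nonneg (sub_nonneg.2 h), abs_sub_comm]
  rw [abs_le] at ha hη
  refine le_trans ?_ (le_abs_self _)
  -- To the left of the centre the phase decreases, hence the sign. The slope involves (ξ/2 - t)(ξ -
  -- t)^(α - 2), which is at least (ξ/4)(2ξ)⁻¹ = 1/8, as α - 2 > -1 and 2ξ ≥ 1.
  have := (convex_Icc (-(ξ / 4)) (ξ / 4)).mul_sub_le_image_sub_of_le_deriv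
    (f := -phase α ξ) (C := α * (α - 1) / 8)
    (fun t _ => (hasDerivAt_phase hα₁ ξ t).neg.continuousAt.continuousWithinAt)
    (fun t _ => (hasDerivAt_phase hα₁ ξ t).neg.differentiableAt.differentiableWithinAt)
    (fun t ht => by
      rw [interior_Icc] at ht
      rw [(hasDerivAt_phase hα₁ ξ t).neg.deriv]
      have h1 := le_oddPow_sub_oddPow hα₁ hα₂ (m := ξ / 2) (t := ξ / 2 - t) (by linarith)
        (by linarith [ht.2])
      rw [show ξ / 2 + (ξ / 2 - t) = ξ - t by ring, sub_sub_cancel] at h1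
      have h2 : ξ / 4 ≤ ξ / 2 - t := by linarith [ht.2]
      have h3 : (2 * ξ) ^ (α - 2) ≤ (ξ - t) ^ (α - 2) :=
        Real.rpow_le_rpow_of_nonpos (by linarith [ht.2]) (by linarith [ht.1]) (by linarith)
      have h4 : (2 * ξ) ^ (-1 : ℝ) ≤ (2 * ξ) ^ (α - 2) :=
        Real.rpow_le_rpow_of_exponent_le (by linarith) (by linarith)
      have h5 : (1 / 8 : ℝ) ≤ (ξ / 2 - t) * (ξ - t) ^ (α - 2) := by
        calc (1 / 8 : ℝ) = ξ / 4 * (2 * ξ) ^ (-1 : ℝ) := by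
              rw [Real.rpow_neg_one]; field_simp; norm_num
          _ ≤ _ := by
              gcongr
              · linarith
              · exact h4.trans h3
      have h6 : (α - 1) * (1 / 8) ≤ oddPow α (ξ - t) - oddPow α t :=
        (mul_le_mul_of_nonneg_left h5 (by linarith)).trans (by rwa [← mul_assoc])
      have h7 := mul_le_mul_of_nonneg_left h6 (show 0 ≤ α by linarith)
      linarith)
    a ha η hη h
  simp only [Pi.neg_apply] at this
  linarith

/-! ### The kernel bound -/

/-- The integral of `⟨l (η - a)⟩ ^ (-r)` is `O(1 / l)`, uniformly in `a` and in the scale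
`l ≤ 1`, for all `r > 1`. -/
def BracketBound (μ : Measure ℝ) : Prop :=
  ∀ r : ℝ, 1 < r → ∃ C : ℝ≥0, ∀ a l : ℝ, 0 < l → l ≤ 1 →
    ∫⁻ η, ENNReal.ofReal (l * bracket (l * (η - a)) ^ (-r)) ∂μ ≤ C

theorem BracketBound.sub {μ : Measure ℝ} (hμ : BracketBound μ) {r : ℝ} (hr : 1 < r) :
    ∃ C : ℝ≥0, ∀ a : ℝ, ∫⁻ η, ENNReal.ofReal (bracket (η - a) ^ (-r)) ∂μ ≤ C := by
  obtain ⟨C, hC⟩ := hμ r hr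
  exact ⟨C, fun a => by simpa using hC a 1 one_pos le_rfl⟩

/-- The curvature factor (ξ + d)^(α - 2) is governed by the larger of d and 1 + ξ. If d dominates,
the growth is d^α; otherwise it is (l d)² with l² = (1 + ξ)^(α - 2). -/
theorem rpow_neg_le_of_curvature {α p κ : ℝ} (hα₁ : 1 < α) (hα₂ : α < 2) (hp : 0 < p)
    (hκ : 0 < κ) :
    ∃ C : ℝ, 0 < C ∧ ∀ ξ d B : ℝ, 0 ≤ ξ → 0 ≤ d → 1 ≤ B →
      1 + κ * d ^ 2 * (ξ + d) ^ (α - 2) ≤ 3 * B →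
      B ^ (-p) ≤ C * ((1 + d) ^ (-(α * p)) +
        (1 + (1 + ξ) ^ (-(1 - α / 2)) * d) ^ (-(2 * p))) := by
  -- Here 24 = 3 · 2 · 4: the factor 3 from the hypothesis, 2 from 2^(α - 2) ≥ 1/2, and 4 from (1 +
  -- d)^α ≤ 4 d^α.
  set C₁ : ℝ := 24 / κ
  set C₂ : ℝ := (2 + 4 / κ) * 3
  have hC₁ : 0 < C₁ := by positivity
  have hC₂ : 0 < C₂ := by positivity
  have htwo : (1 / 2 : ℝ) ≤ 2 ^ (α - 2) := by
    calc (1 / 2 : ℝ) = 2 ^ (-1 : ℝ) := by rw [Real.rpow_neg_one]; norm_num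
      _ ≤ _ := Real.rpow_le_rpow_of_exponent_le (by norm_num) (by linarith)
  refine ⟨C₁ ^ p + C₂ ^ p, by positivity, fun ξ d B hξ hd hB h => ?_⟩
  have hB0 : 0 < B := by linarith
  set l : ℝ := (1 + ξ) ^ (-(1 - α / 2)) with hl
  have hl0 : 0 < l := by positivity
  have hA₁ : 0 ≤ (1 + d) ^ (-(α * p)) := by positivity
  have hA₂ : 0 ≤ (1 + l * d) ^ (-(2 * p)) := by positivity
  rcases le_total (1 + ξ) d with hc | hc
  · have hd0 : 0 < d := by linarith
    have h1 : (1 / 2 : ℝ) * d ^ (α - 2) ≤ (ξ + d) ^ (α - 2) := by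
      calc (1 / 2 : ℝ) * d ^ (α - 2) ≤ 2 ^ (α - 2) * d ^ (α - 2) := by gcongr
        _ = (2 * d) ^ (α - 2) := (Real.mul_rpow two_pos.le hd).symm
        _ ≤ _ := Real.rpow_le_rpow_of_nonpos (by linarith) (by linarith) (by linarith)
    have h2 : d ^ 2 * d ^ (α - 2) = d ^ α := by
      rw [← Real.rpow_natCast, ← Real.rpow_add hd0]; norm_num
    have h3 : (1 + d) ^ α ≤ 4 * d ^ α := by
      calc (1 + d) ^ α ≤ (2 * d) ^ α := by gcongr; linarith
        _ = 2 ^ α * d ^ α := Real.mul_rpow two_pos.le hd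
        _ ≤ 2 ^ (2 : ℝ) * d ^ α := by gcongr; norm_num
        _ = _ := by norm_num
    have h4 : (1 + d) ^ α ≤ C₁ * B := by
      have h5 : κ / 8 * (1 + d) ^ α ≤ 3 * B := by
        calc κ / 8 * (1 + d) ^ α ≤ κ / 8 * (4 * d ^ α) := by gcongr
          _ = κ * d ^ 2 * (1 / 2 * d ^ (α - 2)) := by rw [← h2]; ring
          _ ≤ κ * d ^ 2 * (ξ + d) ^ (α - 2) := by gcongr
          _ ≤ _ := by linarith
      calc (1 + d) ^ α = 8 / κ * (κ / 8 * (1 + d) ^ α) := by field_simp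
        _ ≤ 8 / κ * (3 * B) := by gcongr
        _ = _ := by simp only [C₁]; ring
    have h5 := rpow_neg_le_of_le_mul (by positivity) hB0 hC₁ hp.le h4
    rw [← Real.rpow_mul (by linarith), mul_neg] at h5
    have : 0 ≤ C₁ ^ p * (1 + l * d) ^ (-(2 * p)) := by positivity
    have : 0 ≤ C₂ ^ p * ((1 + d) ^ (-(α * p)) + (1 + l * d) ^ (-(2 * p))) := by positivity
    linarith
  · have h1 : κ / 2 * (l * d) ^ 2 ≤ κ * d ^ 2 * (ξ + d) ^ (α - 2) := by
      rcases hd.eq_or_lt with rfl | hd0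
      · simp
      have h2 : (1 / 2 : ℝ) * (1 + ξ) ^ (α - 2) ≤ (ξ + d) ^ (α - 2) := by
        calc (1 / 2 : ℝ) * (1 + ξ) ^ (α - 2) ≤ 2 ^ (α - 2) * (1 + ξ) ^ (α - 2) := by gcongr
          _ = (2 * (1 + ξ)) ^ (α - 2) := (Real.mul_rpow two_pos.le (by linarith)).symm
          _ ≤ _ := Real.rpow_le_rpow_of_nonpos (by linarith) (by linarith) (by linarith)
      have h3 : l ^ 2 = (1 + ξ) ^ (α - 2) := by
        rw [hl, ← Real.rpow_natCast, ← Real.rpow_mul (by linarith)]; congr 1; push_cast; ring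
      calc κ / 2 * (l * d) ^ 2 = κ * d ^ 2 * (1 / 2 * (1 + ξ) ^ (α - 2)) := by rw [← h3]; ring
        _ ≤ _ := by gcongr
    have h4 : (1 + l * d) ^ (2 : ℝ) ≤ C₂ * B := by
      have h5 : 1 + κ / 2 * (l * d) ^ 2 ≤ 3 * B := by linarith
      calc (1 + l * d) ^ (2 : ℝ) = (1 + l * d) ^ 2 := by norm_cast
        _ ≤ 2 + 2 * (l * d) ^ 2 := by nlinarith [sq_nonneg (1 - l * d)]
        _ ≤ 2 + 2 * (l * d) ^ 2 + (4 / κ + κ * (l * d) ^ 2) := by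
            have : 0 ≤ 4 / κ + κ * (l * d) ^ 2 := by positivity
            linarith
        _ = (2 + 4 / κ) * (1 + κ / 2 * (l * d) ^ 2) := by field_simp; ring
        _ ≤ (2 + 4 / κ) * (3 * B) := by gcongr
        _ = _ := by simp only [C₂]; ring
    have h5 := rpow_neg_le_of_le_mul (by positivity) hB0 hC₂ hp.le h4
    rw [← Real.rpow_mul (by positivity), mul_neg] at h5
    have : 0 ≤ C₂ ^ p * (1 + d) ^ (-(α * p)) := by positivity
    have : 0 ≤ C₁ ^ p * ((1 + d) ^ (-(α * p)) + (1 + l * d) ^ (-(2 * p))) := by positivity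
    linarith

/-- The majorant of the kernel which comes from the neighbourhood of one side of the centre. -/
def sideMajorant (α p ξ a η : ℝ) : ℝ :=
  bracket (η - a) ^ (-(α * p)) + bracket ξ ^ (-(1 - α / 2)) *
    bracket (bracket ξ ^ (-(1 - α / 2)) * (η - a)) ^ (-(2 * p))

theorem sideMajorant_nonneg (α p ξ a η : ℝ) : 0 ≤ sideMajorant α p ξ a η := by
  have := bracket_pos (η - a)
  have := bracket_pos ξ
  have := bracket_pos (bracket ξ ^ (-(1 - α / 2)) * (η - a))
  unfold sideMajorant
  positivity

theorem sideMajorant_neg (α p ξ a η : ℝ) :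
    sideMajorant α p (-ξ) a (-η) = sideMajorant α p ξ (-a) η := by
  unfold sideMajorant
  rw [show -η - a = -(η - -a) by ring, bracket_neg, bracket_neg, mul_neg, bracket_neg]

/-- The majorant of the kernel which comes from the neighbourhood of zero. -/
def zeroMajorant (α p a η : ℝ) : ℝ :=
  bracket η ^ (-(1 - α / 2 + p)) + bracket (η - a) ^ (-(1 - α / 2 + p))

theorem zeroMajorant_nonneg (α p a η : ℝ) : 0 ≤ zeroMajorant α p a η := by
  have := bracket_pos (η - a)
  have := bracket_pos η
  unfold zeroMajorant
  positivity

theorem zeroMajorant_neg (α p a η : ℝ) :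
    zeroMajorant α p a (-η) = zeroMajorant α p (-a) η := by
  unfold zeroMajorant
  rw [show -η - a = -(η - -a) by ring, bracket_neg, bracket_neg]

/-- The set S stands for either side of the centre ξ/2, where the phase is quadratically separating.
The restriction |η| ≥ ξ/4 turns the weight in η into 4l, the factor needed to normalize the integral
of a bracket at scale l. -/
theorem exists_kernel_side {α p : ℝ} (hα₁ : 1 < α) (hα₂ : α < 2) (hp : 0 < p) :
    ∃ C : ℝ, 0 < C ∧ ∀ (ξ τ : ℝ) (S : Set ℝ), 0 ≤ ξ → S.Nonempty →
      (∀ η ∈ S, ∀ a ∈ S, α * (α - 1) / 2 * |η - a| ^ 2 * (ξ + |η - a|) ^ (α - 2) ≤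
        |phase α ξ η - phase α ξ a|) →
      ∃ a, ∀ η ∈ S, ξ / 4 ≤ |η| →
        bracket η ^ (-(1 - α / 2)) * bracket (τ - phase α ξ η) ^ (-p) ≤
          C * sideMajorant α p ξ a η := by
  have hκ : 0 < α * (α - 1) / 2 := by
    have : 0 < α - 1 := by linarith
    positivity
  obtain ⟨C, hC0, hC⟩ := rpow_neg_le_of_curvature hα₁ hα₂ hp hκ
  refine ⟨C * 4, by positivity, fun ξ τ S hξ hS hphase => ?_⟩
  obtain ⟨a, haS, ha⟩ := exists_bracket_sub_le hS (phase α ξ) τ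
  refine ⟨a, fun η hη hηξ => ?_⟩
  have hη0 := bracket_pos η
  have hB0 := bracket_pos (τ - phase α ξ η)
  have hbξ : bracket ξ = 1 + ξ := by rw [bracket, abs_of_nonneg hξ]
  have hl0 : 0 < (1 + ξ) ^ (-(1 - α / 2)) := by positivity
  have h1 := hC ξ |η - a| (bracket (τ - phase α ξ η)) hξ (abs_nonneg _) (one_le_bracket _) (by
    have h2 := ha η hη
    have h3 := hphase η hη a haS
    rw [bracket] at h2
    linarith)
  have h2 : bracket η ^ (-(1 - α / 2)) ≤ 1 :=
    Real.rpow_le_one_of_one_le_of_nonpos (one_le_bracket η) (by linarith)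
  have h3 : bracket η ^ (-(1 - α / 2)) ≤ 4 * (1 + ξ) ^ (-(1 - α / 2)) := by
    have h4 : 1 + ξ ≤ 4 * bracket η := by unfold bracket; linarith
    refine (rpow_neg_le_of_le_mul (by linarith) hη0 four_pos (by linarith) h4).trans ?_
    gcongr
    calc (4 : ℝ) ^ (1 - α / 2) ≤ 4 ^ (1 : ℝ) :=
          Real.rpow_le_rpow_of_exponent_le (by norm_num) (by linarith)
      _ = 4 := Real.rpow_one 4
  have e1 : (1 + |η - a|) = bracket (η - a) := rfl
  have e2 : 1 + (1 + ξ) ^ (-(1 - α / 2)) * |η - a| =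
      bracket ((1 + ξ) ^ (-(1 - α / 2)) * (η - a)) := by
    rw [bracket, abs_mul, abs_of_pos hl0]
  rw [e1, e2] at h1
  have hx := bracket_pos (η - a)
  have hy := bracket_pos ((1 + ξ) ^ (-(1 - α / 2)) * (η - a))
  set X := bracket (η - a) ^ (-(α * p))
  set Y := bracket ((1 + ξ) ^ (-(1 - α / 2)) * (η - a)) ^ (-(2 * p))
  have hX : 0 ≤ X := by positivity
  have hY : 0 ≤ Y := by positivity
  rw [sideMajorant, hbξ]
  calc _ ≤ bracket η ^ (-(1 - α / 2)) * (C * (X + Y)) := by gcongr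
    _ = C * (bracket η ^ (-(1 - α / 2)) * X + bracket η ^ (-(1 - α / 2)) * Y) := by ring
    -- The far term X is integrable by itself, so the weight is dropped there and spent only on Y.
    _ ≤ C * (1 * X + (4 * (1 + ξ) ^ (-(1 - α / 2))) * Y) := by gcongr
    _ ≤ C * (4 * X + (4 * (1 + ξ) ^ (-(1 - α / 2))) * Y) := by gcongr; norm_num
    _ = _ := by ring

/-- Here the weight may be of size 1 even for large ξ, so it cannot offset a loss 1/l. The slope of
the phase gives decay ⟨η - a⟩^(-p) instead, and the weight raises the exponent to 1 - α/2 + p. -/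
theorem exists_kernel_near_zero {α p : ℝ} (hα₁ : 1 < α) (hα₂ : α < 2) (hp : 0 < p) :
    ∃ C : ℝ, 0 < C ∧ ∀ ξ τ : ℝ, 0 ≤ ξ → ∃ a, ∀ η, |η| ≤ ξ / 4 →
        bracket η ^ (-(1 - α / 2)) * bracket (τ - phase α ξ η) ^ (-p) ≤
          C * zeroMajorant α p a η := by
  set κ : ℝ := α * (α - 1) / 8
  have hκ : 0 < κ := by
    have : 0 < α - 1 := by linarith
    simp only [κ]
    positivity
  set C : ℝ := (3 * (1 + 1 / κ)) ^ p + 2 ^ p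
  refine ⟨C, by positivity, fun ξ τ hξ => ?_⟩
  rcases le_total 1 ξ with h1 | h1
  · obtain ⟨a, haS, ha⟩ := exists_bracket_sub_le (S := {η | |η| ≤ ξ / 4})
      ⟨0, by simpa using div_nonneg hξ four_pos.le⟩ (phase α ξ) τ
    refine ⟨a, fun η hη => ?_⟩
    have hη0 := bracket_pos η
    have hx := bracket_pos (η - a)
    have hB0 := bracket_pos (τ - phase α ξ η)
    have h2 : bracket (η - a) ≤ (3 * (1 + 1 / κ)) * bracket (τ - phase α ξ η) := by
      have h3 := le_abs_phase_sub_phase_near_zero hα₁ hα₂ h1 haS hη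
      have h4 := ha η hη
      calc bracket (η - a) ≤ (1 + 1 / κ) * (1 + κ * |η - a|) := by
            have : 0 ≤ 1 / κ + κ * |η - a| := by positivity
            have e : (1 + 1 / κ) * (1 + κ * |η - a|) =
                1 + |η - a| + (1 / κ + κ * |η - a|) := by field_simp; ring
            rw [e, bracket]; linarith
        _ ≤ (1 + 1 / κ) * (3 * bracket (τ - phase α ξ η)) := by
            gcongr
            exact le_trans (add_le_add_right h3 1) h4
        _ = _ := by ring
    have h5 := rpow_neg_le_of_le_mul hx hB0 (by positivity) hp.le h2
    have h6 := bracket_rpow_neg_mul_le (a := 1 - α / 2) (b := p) (by linarith) hp.le η (η - a)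
    have h7 : (3 * (1 + 1 / κ)) ^ p ≤ C := le_add_of_nonneg_right (by positivity)
    calc _ ≤ bracket η ^ (-(1 - α / 2)) * ((3 * (1 + 1 / κ)) ^ p * bracket (η - a) ^ (-p)) := by
          gcongr
      _ = (3 * (1 + 1 / κ)) ^ p * (bracket η ^ (-(1 - α / 2)) * bracket (η - a) ^ (-p)) := by ring
      _ ≤ C * zeroMajorant α p a η := by
          unfold zeroMajorant
          gcongr
  -- For ξ ≤ 1 the variable η is bounded, so ⟨η⟩^(-p) is bounded below and no information on the
  -- phase is needed.
  · refine ⟨0, fun η hη => ?_⟩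
    have hη0 := bracket_pos η
    have hB0 := bracket_pos (τ - phase α ξ η)
    have h2 : bracket η ≤ 2 * 1 := by unfold bracket; linarith
    have h3 := rpow_neg_le_of_le_mul hη0 one_pos two_pos hp.le h2
    rw [Real.one_rpow] at h3
    have h4 : bracket (τ - phase α ξ η) ^ (-p) ≤ 1 :=
      Real.rpow_le_one_of_one_le_of_nonpos (one_le_bracket _) (by linarith)
    have h5 : (2 : ℝ) ^ p ≤ C := le_add_of_nonneg_left (by positivity)
    calc _ ≤ bracket η ^ (-(1 - α / 2)) * (2 ^ p * bracket η ^ (-p)) := by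
          gcongr
          exact h4.trans h3
      _ = 2 ^ p * bracket η ^ (-(1 - α / 2 + p)) := by
          rw [mul_left_comm, ← Real.rpow_add hη0]; ring_nf
      _ ≤ C * zeroMajorant α p 0 η := by
          gcongr
          exact le_add_of_nonneg_right (by rw [sub_zero]; positivity)

/-- The pointwise bound of the kernel. -/
theorem exists_kernel_le {α p : ℝ} (hα₁ : 1 < α) (hα₂ : α < 2) (hp : 0 < p) :
    ∃ C : ℝ, 0 < C ∧ ∀ ξ τ : ℝ, ∃ a b c, ∀ η,
      bracket η ^ (-(1 - α / 2)) * bracket (τ - phase α ξ η) ^ (-p) ≤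
        C * (zeroMajorant α p a η + sideMajorant α p ξ b η + sideMajorant α p ξ c η) := by
  obtain ⟨C₁, hC₁, h₁⟩ := exists_kernel_near_zero hα₁ hα₂ hp
  obtain ⟨C₂, hC₂, h₂⟩ := exists_kernel_side hα₁ hα₂ hp
  refine ⟨C₁ + C₂, by positivity, fun ξ τ => ?_⟩
  wlog hξ : 0 ≤ ξ generalizing ξ
  · obtain ⟨a, b, c, h⟩ := this (-ξ) (by linarith)
    refine ⟨-a, -b, -c, fun η => ?_⟩
    have := h (-η)
    rwa [phase_neg, bracket_neg, sideMajorant_neg, sideMajorant_neg, zeroMajorant_neg] at this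
  obtain ⟨a, ha⟩ := h₁ ξ τ hξ
  obtain ⟨b, hb⟩ := h₂ ξ τ (Set.Iic (ξ / 2)) hξ Set.nonempty_Iic
    fun η hη a ha => le_abs_phase_sub_phase_left hα₁ hα₂ hξ ha hη
  obtain ⟨c, hc⟩ := h₂ ξ τ (Set.Ici (ξ / 2)) hξ Set.nonempty_Ici
    fun η hη a ha => le_abs_phase_sub_phase_right hα₁ hα₂ hξ ha hη
  refine ⟨a, b, c, fun η => ?_⟩
  have n1 := zeroMajorant_nonneg α p a η
  have n2 := sideMajorant_nonneg α p ξ b η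
  have n3 := sideMajorant_nonneg α p ξ c η
  rcases le_total |η| (ξ / 4) with h | h
  · exact (ha η h).trans (by nlinarith)
  rcases le_total η (ξ / 2) with h' | h'
  · exact (hb η h' h).trans (by nlinarith)
  · exact (hc η h' h).trans (by nlinarith)

/-- The three exponent conditions make the three kinds of bracket integrable: far from a, near
frequency zero, and at the curvature scale l, in this order. The condition on s says 2s ≥ 1 - α/2.
-/
theorem lintegral_kernel_le {μ : Measure ℝ} (hμ : BracketBound μ) {α p s : ℝ} (hα₁ : 1 < α)
    (hα₂ : α < 2) (hs : (2 - α) / 4 ≤ s) (hp₁ : 1 < α * p) (hp₂ : 1 < 1 - α / 2 + p)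
    (hp₃ : 1 < 2 * p) :
    ∃ C : ℝ≥0, ∀ ξ τ : ℝ, ∫⁻ η, ENNReal.ofReal
      (bracket η ^ (-(2 * s)) * bracket (τ - phase α ξ η) ^ (-p)) ∂μ ≤ C := by
  have hp : 0 < p := by linarith
  obtain ⟨C, hC0, hC⟩ := exists_kernel_le hα₁ hα₂ hp
  obtain ⟨K₁, hK₁⟩ := hμ.sub hp₁
  obtain ⟨K₂, hK₂⟩ := hμ.sub hp₂
  obtain ⟨K₃, hK₃⟩ := hμ _ hp₃
  have hzero : ∀ a, ∫⁻ η, ENNReal.ofReal (zeroMajorant α p a η) ∂μ ≤ K₂ + K₂ := fun a => by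
    unfold zeroMajorant
    rw [lintegral_congr fun η => ENNReal.ofReal_add (Real.rpow_nonneg (bracket_pos η).le _)
      (Real.rpow_nonneg (bracket_pos (η - a)).le _), lintegral_add_left (by fun_prop)]
    exact add_le_add (by simpa using hK₂ 0) (hK₂ a)
  have hside : ∀ ξ a, ∫⁻ η, ENNReal.ofReal (sideMajorant α p ξ a η) ∂μ ≤ K₁ + K₃ := fun ξ a => by
    have hl : 0 < bracket ξ ^ (-(1 - α / 2)) := Real.rpow_pos_of_pos (bracket_pos ξ) _
    unfold sideMajorant
    rw [lintegral_congr fun η => ENNReal.ofReal_add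
      (Real.rpow_nonneg (bracket_pos (η - a)).le _)
      (mul_nonneg hl.le (Real.rpow_nonneg (bracket_pos _).le _)),
      lintegral_add_left (by fun_prop)]
    exact add_le_add (hK₁ a) (hK₃ a _ hl
      (Real.rpow_le_one_of_one_le_of_nonpos (one_le_bracket ξ) (by linarith)))
  refine ⟨C.toNNReal * (K₂ + K₂ + (K₁ + K₃) + (K₁ + K₃)), fun ξ τ => ?_⟩
  obtain ⟨a, b, c, h⟩ := hC ξ τ
  have hle : ∀ η, ENNReal.ofReal (bracket η ^ (-(2 * s)) * bracket (τ - phase α ξ η) ^ (-p)) ≤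
      C.toNNReal * (ENNReal.ofReal (zeroMajorant α p a η) +
        ENNReal.ofReal (sideMajorant α p ξ b η) + ENNReal.ofReal (sideMajorant α p ξ c η)) := by
    intro η
    have n1 := zeroMajorant_nonneg α p a η
    have n2 := sideMajorant_nonneg α p ξ b η
    have n3 := sideMajorant_nonneg α p ξ c η
    -- Rewriting backwards with `ENNReal.ofReal.eq_1` reads the coercion of `C.toNNReal` as
    -- `ENNReal.ofReal C`.
    rw [← ENNReal.ofReal_add n1 n2, ← ENNReal.ofReal_add (add_nonneg n1 n2) n3,
      ← ENNReal.ofReal.eq_1, ← ENNReal.ofReal_mul hC0.le]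
    refine ENNReal.ofReal_le_ofReal (le_trans ?_ (h η))
    have := bracket_pos (τ - phase α ξ η)
    gcongr
    · exact one_le_bracket η
    · linarith
  have m1 : Measurable fun η => ENNReal.ofReal (zeroMajorant α p a η) := by
    unfold zeroMajorant; fun_prop
  have m2 : ∀ b, Measurable fun η => ENNReal.ofReal (sideMajorant α p ξ b η) := fun b => by
    unfold sideMajorant; fun_prop
  calc _ ≤ _ := lintegral_mono hle
    _ = C.toNNReal * (∫⁻ η, ENNReal.ofReal (zeroMajorant α p a η) ∂μ +
        ∫⁻ η, ENNReal.ofReal (sideMajorant α p ξ b η) ∂μ +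
        ∫⁻ η, ENNReal.ofReal (sideMajorant α p ξ c η) ∂μ) := by
      rw [lintegral_const_mul' _ _ ENNReal.coe_ne_top, lintegral_add_right _ (m2 c),
        lintegral_add_right _ (m2 b)]
    _ ≤ _ := by
      push_cast
      gcongr
      · exact hzero a
      · exact hside ξ b
      · exact hside ξ c

/-! ### Scale-uniform bracket integrals for Lebesgue and counting measure -/

theorem bracketBound_volume : BracketBound volume := by
  intro r hr
  have hint : Integrable (fun x : ℝ => bracket x ^ (-r)) := by
    simpa [bracket] using integrable_one_add_norm (E := ℝ) (μ := volume) (r := r) (by simpa using hr)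
  have hmeas : Measurable fun x : ℝ => ENNReal.ofReal (bracket x ^ (-r)) := by fun_prop
  have hfin : ∫⁻ x, ENNReal.ofReal (bracket x ^ (-r)) ≠ ∞ := hint.lintegral_lt_top.ne
  refine ⟨(∫⁻ x, ENNReal.ofReal (bracket x ^ (-r))).toNNReal, fun a l hl _ => ?_⟩
  rw [ENNReal.coe_toNNReal hfin,
    lintegral_sub_right_eq_self (fun η => ENNReal.ofReal (l * bracket (l * η) ^ (-r))) a]
  simp_rw [ENNReal.ofReal_mul hl.le]
  rw [lintegral_const_mul' _ _ ENNReal.ofReal_ne_top,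
    ← lintegral_map (g := fun η => l * η) hmeas (by fun_prop),
    Real.map_volume_mul_left hl.ne', lintegral_smul_measure, smul_eq_mul, ← mul_assoc,
    ← ENNReal.ofReal_mul hl.le, abs_of_pos (inv_pos.2 hl), mul_inv_cancel₀ hl.ne',
    ENNReal.ofReal_one, one_mul]

/-- Comparison of sum and integral: since l ≤ 1, the argument l(η - a) varies by at most 1 over a
unit interval, so the bracket at most doubles there. -/
theorem bracketBound_count_int :
    BracketBound ((Measure.count : Measure ℤ).map ((↑) : ℤ → ℝ)) := by
  intro r hr
  obtain ⟨C, hC⟩ := bracketBound_volume r hr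
  refine ⟨(2 ^ r : ℝ).toNNReal * C, fun a l hl hl1 => ?_⟩
  rw [lintegral_map (by fun_prop) (by fun_prop), lintegral_count]
  have hk : ∀ k : ℤ, ENNReal.ofReal (l * bracket (l * (k - a)) ^ (-r)) ≤
      (2 ^ r : ℝ).toNNReal * ∫⁻ η in Set.Ioc (k : ℝ) (k + 1),
        ENNReal.ofReal (l * bracket (l * (η - a)) ^ (-r)) := fun k => by
    rw [← lintegral_const_mul' _ _ ENNReal.coe_ne_top]
    calc ENNReal.ofReal (l * bracket (l * (k - a)) ^ (-r)) =
          ∫⁻ η in Set.Ioc (k : ℝ) (k + 1), ENNReal.ofReal (l * bracket (l * (k - a)) ^ (-r)) := by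
          simp
      _ ≤ _ := by
          refine setLIntegral_mono (by fun_prop) fun η hη => ?_
          rw [← ENNReal.ofReal.eq_1, ← ENNReal.ofReal_mul (by positivity)]
          refine ENNReal.ofReal_le_ofReal ?_
          have h1 : bracket (l * (η - a)) ≤ 2 * bracket (l * (k - a)) := by
            have h2 : |l * (η - a)| ≤ |l * (k - a)| + |l * (η - k)| := by
              rw [show l * (η - a) = l * (k - a) + l * (η - k) by ring]
              exact abs_add_le _ _
            have h3 : |l * (η - k)| ≤ 1 := by
              rw [abs_of_nonneg (mul_nonneg hl.le (by linarith [hη.1]))]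
              nlinarith [hη.1, hη.2]
            unfold bracket
            linarith [abs_nonneg (l * (k - a))]
          have h4 := rpow_neg_le_of_le_mul (bracket_pos _) (bracket_pos _) two_pos
            (by linarith : 0 ≤ r) h1
          calc _ ≤ l * (2 ^ r * bracket (l * (η - a)) ^ (-r)) := by gcongr
            _ = _ := by ring
  calc _ ≤ _ := ENNReal.tsum_le_tsum hk
    _ = (2 ^ r : ℝ).toNNReal * ∑' k : ℤ, ∫⁻ η in Set.Ioc (k : ℝ) (k + 1),
        ENNReal.ofReal (l * bracket (l * (η - a)) ^ (-r)) := ENNReal.tsum_mul_left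
    _ = (2 ^ r : ℝ).toNNReal * ∫⁻ η, ENNReal.ofReal (l * bracket (l * (η - a)) ^ (-r)) := by
        rw [← lintegral_iUnion (fun k => measurableSet_Ioc) (Set.pairwise_disjoint_Ioc_intCast ℝ),
          iUnion_Ioc_intCast, setLIntegral_univ]
    _ ≤ _ := by
        push_cast
        gcongr
        exact hC a l hl hl1

/-- The bound of the kernel of the bilinear estimate, which is the reciprocal of the product of the
squares of the two weights. -/
theorem exists_lintegral_weight_le {B : Type*} [AddCommGroup B] [MeasurableSpace B]
    {β : Measure B} [SFinite β] {ι : B →+ ℝ} (hι : Measurable ι) (hβ : BracketBound (β.map ι))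
    {α ε s : ℝ} (hα₁ : 1 < α) (hα₂ : α < 2) (hs : (2 - α) / 4 ≤ s) (hε : 0 < ε)
    (hε₁ : ε < (2 - α) / 4) (hε₂ : ε < (α - 1) / 4) :
    ∃ K : ℝ≥0, ∀ z : ℝ × B, ∫⁻ y : ℝ × B,
      (ENNReal.ofReal (weight α 0 (1 / 2 - ε) (z - y).1 (ι (z - y).2)) ^ 2 *
        ENNReal.ofReal (weight α s (1 / 2 + ε) y.1 (ι y.2)) ^ 2)⁻¹
          ∂((volume : Measure ℝ).prod β) ≤ K := by
  set p : ℝ := 1 - 2 * ε with hp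
  set q : ℝ := 1 + 2 * ε with hq
  have hp0 : 0 ≤ p := by linarith
  obtain ⟨K₁, hK₁⟩ := bracketBound_volume.sub (r := q) (by linarith)
  -- For αp > 1: ε < (α - 1)/4 gives αp > α(3 - α)/2, which exceeds 1 because (α - 1)(2 - α) > 0.
  -- The other two conditions follow from ε < (2 - α)/4.
  obtain ⟨K₂, hK₂⟩ := lintegral_kernel_le hβ hα₁ hα₂ hs (p := p) (by nlinarith) (by linarith)
    (by linarith)
  refine ⟨(2 ^ p : ℝ).toNNReal * (K₁ + K₁) * K₂, fun z => ?_⟩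
  have hpt : ∀ t η, (ENNReal.ofReal (weight α 0 (1 / 2 - ε) (z.1 - t) (ι z.2 - η)) ^ 2 *
      ENNReal.ofReal (weight α s (1 / 2 + ε) t η) ^ 2)⁻¹ ≤
      (2 ^ p : ℝ).toNNReal * ENNReal.ofReal (bracket η ^ (-(2 * s)) *
        bracket (z.1 - phase α (ι z.2) η) ^ (-p)) *
      (ENNReal.ofReal (bracket (t - (z.1 - |ι z.2 - η| ^ α)) ^ (-q)) +
        ENNReal.ofReal (bracket (t - |η| ^ α) ^ (-q))) := fun t η => by
    set x := z.1 - t - |ι z.2 - η| ^ α with hx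
    set y := t - |η| ^ α with hy
    have hx0 := bracket_pos x
    have hy0 := bracket_pos y
    have hη0 := bracket_pos η
    have e1 : weight α 0 (1 / 2 - ε) (z.1 - t) (ι z.2 - η) ^ 2 = bracket x ^ p := by
      rw [weight, Real.rpow_zero, one_mul, ← Real.rpow_natCast, ← Real.rpow_mul hx0.le, hp]
      congr 1; push_cast; ring
    have e2 : weight α s (1 / 2 + ε) t η ^ 2 = bracket η ^ (2 * s) * bracket y ^ q := by
      rw [weight, mul_pow, ← Real.rpow_natCast, ← Real.rpow_natCast, ← Real.rpow_mul hη0.le,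
        ← Real.rpow_mul hy0.le, hq]
      congr 2 <;> push_cast <;> ring
    -- The resonance identity: the sum of the modulations does not involve t.
    have e3 : x + y = z.1 - phase α (ι z.2) η := by simp only [hx, hy, phase]; ring
    have e4 : bracket (t - (z.1 - |ι z.2 - η| ^ α)) = bracket x := by
      rw [hx, ← bracket_neg]; congr 1; ring
    have hxy0 := bracket_pos (x + y)
    have w1 : 0 ≤ weight α 0 (1 / 2 - ε) (z.1 - t) (ι z.2 - η) := by
      unfold weight; have := bracket_pos (ι z.2 - η); positivity
    have w2 : 0 ≤ weight α s (1 / 2 + ε) t η := by unfold weight; positivity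
    rw [e4, ← e3, ← ENNReal.ofReal_pow w1, ← ENNReal.ofReal_pow w2, e1, e2,
      ← ENNReal.ofReal_mul (by positivity), ← ENNReal.ofReal_inv_of_pos (by positivity),
      ← ENNReal.ofReal_add (by positivity) (by positivity), ← ENNReal.ofReal.eq_1,
      ← ENNReal.ofReal_mul (by positivity), ← ENNReal.ofReal_mul (by positivity)]
    refine ENNReal.ofReal_le_ofReal ?_
    have key := bracket_mul_bracket_rpow_neg_le hp0 (by linarith : p ≤ q) x y
    calc _ = bracket η ^ (-(2 * s)) * (bracket x ^ (-p) * bracket y ^ (-q)) := by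
          rw [Real.rpow_neg hη0.le, Real.rpow_neg hx0.le, Real.rpow_neg hy0.le]
          field_simp
      _ ≤ bracket η ^ (-(2 * s)) *
          (2 ^ p * bracket (x + y) ^ (-p) * (bracket x ^ (-q) + bracket y ^ (-q))) := by gcongr
      _ = _ := by ring
  have hmeas : Measurable fun y : ℝ × B =>
      (ENNReal.ofReal (weight α 0 (1 / 2 - ε) (z.1 - y.1) (ι z.2 - ι y.2)) ^ 2 *
        ENNReal.ofReal (weight α s (1 / 2 + ε) y.1 (ι y.2)) ^ 2)⁻¹ := by
    unfold weight; fun_prop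
  simp_rw [Prod.fst_sub, Prod.snd_sub, map_sub]
  -- The time frequency becomes the inner variable; its integral costs K₁ + K₁, one for each
  -- modulation.
  rw [lintegral_prod_symm _ hmeas.aemeasurable]
  have hphase : Measurable (phase α (ι z.2)) := by unfold phase; fun_prop
  calc _ ≤ ∫⁻ η, ((2 ^ p : ℝ).toNNReal * (K₁ + K₁)) * ENNReal.ofReal (bracket (ι η) ^ (-(2 * s)) *
        bracket (z.1 - phase α (ι z.2) (ι η)) ^ (-p)) ∂β := by
        refine lintegral_mono fun η => ?_
        refine (lintegral_mono fun t => hpt t (ι η)).trans ?_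
        rw [lintegral_const_mul' _ _ (by finiteness), lintegral_add_left (by fun_prop),
          mul_right_comm]
        gcongr
        · exact hK₁ _
        · exact hK₁ _
    _ ≤ _ := by
        rw [lintegral_const_mul' _ _ (by finiteness)]
        push_cast
        gcongr
        rw [← lintegral_map (f := fun η => ENNReal.ofReal (bracket η ^ (-(2 * s)) *
          bracket (z.1 - phase α (ι z.2) η) ^ (-p))) (by fun_prop) hι]
        exact hK₂ _ _

/-! ### A weighted convolution estimate -/

theorem lintegral_mul_sq_le {X : Type*} [MeasurableSpace X] {μ : Measure X} {f g : X → ℝ≥0∞}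
    (hf : AEMeasurable f μ) (hg : AEMeasurable g μ) :
    (∫⁻ x, f x * g x ∂μ) ^ 2 ≤ (∫⁻ x, f x ^ 2 ∂μ) * ∫⁻ x, g x ^ 2 ∂μ := by
  have h := ENNReal.lintegral_mul_le_Lp_mul_Lq μ Real.HolderConjugate.two_two hf hg
  simp only [Pi.mul_apply, ENNReal.rpow_two] at h
  calc _ ≤ _ := pow_le_pow_left' h 2
    _ = _ := by
      rw [mul_pow, ← ENNReal.rpow_natCast, ← ENNReal.rpow_natCast, ← ENNReal.rpow_mul,
        ← ENNReal.rpow_mul]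
      norm_num

/-- An `L²` bound of a convolution by weighted `L²` norms; the finite functions `a` and `b` are
the squares of the weights. -/
theorem lintegral_conv_sq_le {Y : Type*} [AddCommGroup Y] [MeasurableSpace Y] [MeasurableAdd₂ Y]
    [MeasurableSub₂ Y] [MeasurableNeg Y]
    {ν : Measure Y} [SFinite ν] [ν.IsAddLeftInvariant] {F G a b : Y → ℝ≥0∞} (hF : Measurable F)
    (hG : Measurable G) (ha : Measurable a) (hb : Measurable b) (ha0 : ∀ y, a y ≠ 0)
    (ha1 : ∀ y, a y ≠ ∞) (hb0 : ∀ y, b y ≠ 0) (hb1 : ∀ y, b y ≠ ∞) {K : ℝ≥0∞}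
    (hK : ∀ z, ∫⁻ y, (a (z - y) ^ 2 * b y ^ 2)⁻¹ ∂ν ≤ K) :
    ∫⁻ z, (∫⁻ y, F (z - y) * G y ∂ν) ^ 2 ∂ν ≤
      K * ((∫⁻ y, (a y * F y) ^ 2 ∂ν) * ∫⁻ y, (b y * G y) ^ 2 ∂ν) := by
  have hpt : ∀ z, (∫⁻ y, F (z - y) * G y ∂ν) ^ 2 ≤
      K * ∫⁻ y, (a (z - y) * F (z - y)) ^ 2 * (b y * G y) ^ 2 ∂ν := fun z => by
    -- Cauchy–Schwarz is applied to the reciprocal weights against the weighted product; the latter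
    -- is then integrated by Tonelli and translation invariance.
    have h1 : ∀ y, F (z - y) * G y =
        (a (z - y) * b y)⁻¹ * ((a (z - y) * F (z - y)) * (b y * G y)) := fun y => by
      have hab0 : a (z - y) * b y ≠ 0 := mul_ne_zero (ha0 _) (hb0 _)
      have hab1 : a (z - y) * b y ≠ ∞ := ENNReal.mul_ne_top (ha1 _) (hb1 _)
      rw [mul_mul_mul_comm, ← mul_assoc, ENNReal.inv_mul_cancel hab0 hab1, one_mul]
    simp_rw [h1]
    refine (lintegral_mul_sq_le (by fun_prop) (by fun_prop)).trans ?_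
    simp only [mul_pow]
    gcongr
    simpa only [← ENNReal.inv_pow, mul_pow] using hK z
  calc _ ≤ ∫⁻ z, K * ∫⁻ y, (a (z - y) * F (z - y)) ^ 2 * (b y * G y) ^ 2 ∂ν ∂ν :=
        lintegral_mono hpt
    _ = K * ∫⁻ z, ∫⁻ y, (a (z - y) * F (z - y)) ^ 2 * (b y * G y) ^ 2 ∂ν ∂ν :=
        lintegral_const_mul _ (by fun_prop)
    _ = K * ∫⁻ y, ∫⁻ z, (a (z - y) * F (z - y)) ^ 2 * (b y * G y) ^ 2 ∂ν ∂ν := by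
        rw [lintegral_lintegral_swap (by fun_prop)]
    _ = K * ∫⁻ y, (∫⁻ z, (a z * F z) ^ 2 ∂ν) * (b y * G y) ^ 2 ∂ν := by
        congr 2 with y
        rw [lintegral_mul_const _ (by fun_prop),
          lintegral_sub_right_eq_self (fun z => (a z * F z) ^ 2) y]
    _ = _ := by rw [lintegral_const_mul _ (by fun_prop)]

open Filter Topology

/-! ### Oscillatory integrals with a Bessel inequality -/

theorem eLpNorm_two_sq {X E : Type*} [MeasurableSpace X] [NormedAddCommGroup E] (μ : Measure X)
    (f : X → E) : eLpNorm f 2 μ ^ 2 = ∫⁻ x, ‖f x‖ₑ ^ 2 ∂μ := by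
  have := eLpNorm_nnreal_pow_eq_lintegral (μ := μ) (f := f) (p := 2) two_ne_zero
  simpa using this

/-- The transform `∫ e (x, y) V (y) dy`. -/
def oscIntegral {X Y : Type*} [MeasurableSpace Y] (e : X → Y → ℂ) (ν : Measure Y) (V : Y → ℂ)
    (x : X) : ℂ := ∫ y, e x y * V y ∂ν

/-- A unimodular kernel whose oscillatory integrals satisfy a Bessel inequality. -/
structure IsBesselKernel {X Y : Type*} [MeasurableSpace X] [MeasurableSpace Y] (e : X → Y → ℂ)
    (μ : Measure X) (ν : Measure Y) (C : ℝ≥0) : Prop where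
  measurable : Measurable (Function.uncurry e)
  norm_eq : ∀ x y, ‖e x y‖ = 1
  bessel : ∀ V : Y → ℂ, Integrable V ν →
    ∫⁻ x, ‖oscIntegral e ν V x‖ₑ ^ 2 ∂μ ≤ C * ∫⁻ y, ‖V y‖ₑ ^ 2 ∂ν

theorem oscIntegral_congr_ae {X Y : Type*} [MeasurableSpace Y] (e : X → Y → ℂ) {ν : Measure Y}
    {V W : Y → ℂ} (h : V =ᵐ[ν] W) : oscIntegral e ν V = oscIntegral e ν W := by
  funext x
  exact integral_congr_ae (h.mono fun y hy => by simp only [hy])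

section Kernel

variable {X Y : Type*} [MeasurableSpace X] [MeasurableSpace Y] {e : X → Y → ℂ}
  {μ : Measure X} {ν : Measure Y} {C : ℝ≥0}

theorem IsBesselKernel.measurable_right (he : IsBesselKernel e μ ν C) (x : X) :
    Measurable (e x) := he.measurable.comp measurable_prodMk_left

theorem IsBesselKernel.integrable_mul (he : IsBesselKernel e μ ν C) (x : X) {V : Y → ℂ}
    (hV : Integrable V ν) : Integrable (fun y => e x y * V y) ν :=
  hV.bdd_mul (he.measurable_right x).aestronglyMeasurable
    (Eventually.of_forall fun y => (he.norm_eq x y).le)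

theorem IsBesselKernel.oscIntegral_sub (he : IsBesselKernel e μ ν C) {V W : Y → ℂ}
    (hV : Integrable V ν) (hW : Integrable W ν) :
    oscIntegral e ν V - oscIntegral e ν W = oscIntegral e ν (V - W) := by
  funext x
  simp only [oscIntegral, Pi.sub_apply, mul_sub]
  exact (integral_sub (he.integrable_mul x hV) (he.integrable_mul x hW)).symm

theorem IsBesselKernel.stronglyMeasurable_oscIntegral [SFinite ν] (he : IsBesselKernel e μ ν C)
    {V : Y → ℂ} (hV : AEStronglyMeasurable V ν) : StronglyMeasurable (oscIntegral e ν V) := by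
  rw [oscIntegral_congr_ae e hV.ae_eq_mk]
  exact StronglyMeasurable.integral_prod_right
    (f := fun x y => e x y * hV.mk V y)
    ((he.measurable.mul (hV.stronglyMeasurable_mk.measurable.comp measurable_snd)).stronglyMeasurable)

theorem IsBesselKernel.eLpNorm_le (he : IsBesselKernel e μ ν C) {V : Y → ℂ}
    (hV : Integrable V ν) : eLpNorm (oscIntegral e ν V) 2 μ ≤ NNReal.sqrt C * eLpNorm V 2 ν := by
  have h := he.bessel V hV
  rw [← eLpNorm_two_sq, ← eLpNorm_two_sq, ← NNReal.sq_sqrt C, ENNReal.coe_pow, ← mul_pow] at h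
  exact (ENNReal.pow_le_pow_left_iff two_ne_zero).1 h

/-- A tensor product of kernels with Bessel inequalities has a Bessel inequality. -/
theorem IsBesselKernel.prod {X' Y' : Type*} [MeasurableSpace X'] [MeasurableSpace Y']
    {e' : X' → Y' → ℂ} {μ' : Measure X'} {ν' : Measure Y'} {C' : ℝ≥0} [SFinite μ] [SFinite ν]
    [SFinite μ'] [SFinite ν'] (he : IsBesselKernel e μ ν C) (he' : IsBesselKernel e' μ' ν' C') :
    IsBesselKernel (fun (x : X × X') (y : Y × Y') => e x.1 y.1 * e' x.2 y.2)
      (μ.prod μ') (ν.prod ν') (C * C') where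
  measurable := by
    have h1 : Measurable fun z : (X × X') × (Y × Y') => e z.1.1 z.2.1 :=
      he.measurable.comp (g := Function.uncurry e)
        (f := fun z : (X × X') × (Y × Y') => (z.1.1, z.2.1)) (by fun_prop)
    have h2 : Measurable fun z : (X × X') × (Y × Y') => e' z.1.2 z.2.2 :=
      he'.measurable.comp (g := Function.uncurry e')
        (f := fun z : (X × X') × (Y × Y') => (z.1.2, z.2.2)) (by fun_prop)
    exact h1.mul h2
  norm_eq x y := by rw [norm_mul, he.norm_eq, he'.norm_eq, one_mul]
  bessel V hV := by
    wlog hVm : StronglyMeasurable V generalizing V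
    · have hmk := hV.1.ae_eq_mk
      have := this (hV.1.mk V) (hV.congr hmk) hV.1.stronglyMeasurable_mk
      rw [← oscIntegral_congr_ae _ hmk] at this
      rwa [lintegral_congr_ae (hmk.mono fun y hy => by
        simp only [hy] : (fun y => ‖V y‖ₑ ^ 2) =ᵐ[ν.prod ν'] fun y => ‖hV.1.mk V y‖ₑ ^ 2)]
    -- A is the partial transform in the second variable. The first Bessel inequality is used for
    -- fixed x', the second for almost every y, with Tonelli in between.
    set A : Y → X' → ℂ := fun y x' => oscIntegral e' ν' (fun y' => V (y, y')) x' with hA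
    have hAm : StronglyMeasurable (Function.uncurry A) := by
      refine StronglyMeasurable.integral_prod_right
        (f := fun (z : Y × X') y' => e' z.2 y' * V (z.1, y')) (Measurable.stronglyMeasurable ?_)
      have h2 : Measurable fun z : (Y × X') × Y' => e' z.1.2 z.2 :=
        he'.measurable.comp (g := Function.uncurry e')
          (f := fun z : (Y × X') × Y' => (z.1.2, z.2)) (by fun_prop)
      have h3 : Measurable fun z : (Y × X') × Y' => V (z.1.1, z.2) :=
        hVm.measurable.comp (f := fun z : (Y × X') × Y' => (z.1.1, z.2)) (by fun_prop)
      exact h2.mul h3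
    have hint' : ∀ x', Integrable (fun z : Y × Y' => e' x' z.2 * V z) (ν.prod ν') := fun x' =>
      hV.bdd_mul ((he'.measurable_right x').comp measurable_snd).aestronglyMeasurable
        (Eventually.of_forall fun y => (he'.norm_eq x' y.2).le)
    have hint : ∀ x', Integrable (fun y => A y x') ν := fun x' => (hint' x').integral_prod_left
    have hosc : ∀ x x', oscIntegral (fun (x : X × X') (y : Y × Y') => e x.1 y.1 * e' x.2 y.2)
        (ν.prod ν') V (x, x') = oscIntegral e ν (fun y => A y x') x := fun x x' => by
      have h1 : Integrable (fun z : Y × Y' => e x z.1 * (e' x' z.2 * V z)) (ν.prod ν') :=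
        (hint' x').bdd_mul ((he.measurable_right x).comp measurable_fst).aestronglyMeasurable
          (Eventually.of_forall fun y => (he.norm_eq x y.1).le)
      simp only [oscIntegral, mul_assoc]
      rw [integral_prod _ h1]
      refine integral_congr_ae (Eventually.of_forall fun y => ?_)
      simp only [hA, oscIntegral]
      rw [integral_const_mul]
    have hmeas : Measurable fun z : X × X' => ‖oscIntegral e ν (fun y => A y z.2) z.1‖ₑ ^ 2 := by
      have : StronglyMeasurable fun z : X × X' => oscIntegral e ν (fun y => A y z.2) z.1 := by
        refine StronglyMeasurable.integral_prod_right
          (f := fun (z : X × X') y => e z.1 y * A y z.2) (Measurable.stronglyMeasurable ?_)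
        have h2 : Measurable fun z : (X × X') × Y => e z.1.1 z.2 :=
          he.measurable.comp (g := Function.uncurry e)
            (f := fun z : (X × X') × Y => (z.1.1, z.2)) (by fun_prop)
        have h3 : Measurable fun z : (X × X') × Y => A z.2 z.1.2 :=
          hAm.measurable.comp (g := Function.uncurry A)
            (f := fun z : (X × X') × Y => (z.2, z.1.2)) (by fun_prop)
        exact h2.mul h3
      exact this.measurable.enorm.pow_const 2
    calc _ = ∫⁻ z : X × X', ‖oscIntegral e ν (fun y => A y z.2) z.1‖ₑ ^ 2 ∂μ.prod μ' :=
          lintegral_congr fun z => by rw [← hosc]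
      _ = ∫⁻ x', ∫⁻ x, ‖oscIntegral e ν (fun y => A y x') x‖ₑ ^ 2 ∂μ ∂μ' :=
          lintegral_prod_symm _ hmeas.aemeasurable
      _ ≤ ∫⁻ x', C * ∫⁻ y, ‖A y x'‖ₑ ^ 2 ∂ν ∂μ' :=
          lintegral_mono fun x' => he.bessel _ (hint x')
      _ = C * ∫⁻ x', ∫⁻ y, ‖A y x'‖ₑ ^ 2 ∂ν ∂μ' :=
          lintegral_const_mul' _ _ ENNReal.coe_ne_top
      _ = C * ∫⁻ y, ∫⁻ x', ‖A y x'‖ₑ ^ 2 ∂μ' ∂ν := by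
          rw [lintegral_lintegral_swap
            ((hAm.measurable.comp measurable_swap).enorm.pow_const 2).aemeasurable]
      _ ≤ C * ∫⁻ y, C' * ∫⁻ y', ‖V (y, y')‖ₑ ^ 2 ∂ν' ∂ν := by
          refine mul_le_mul' le_rfl (lintegral_mono_ae ?_)
          exact hV.prod_right_ae.mono fun y hy => he'.bessel _ hy
      _ = C * (C' * ∫⁻ y, ∫⁻ y', ‖V (y, y')‖ₑ ^ 2 ∂ν' ∂ν) := by
          rw [lintegral_const_mul' _ _ ENNReal.coe_ne_top]
      _ = _ := by
          rw [lintegral_prod _ (hVm.measurable.enorm.pow_const 2).aemeasurable]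
          push_cast
          ring

/-! ### The transform on `L²` -/

/-- The restriction of `V` to the `n`-th set of an exhaustion by sets of finite measure. -/
def truncation (ν : Measure Y) [SigmaFinite ν] (V : Y → ℂ) (n : ℕ) : Y → ℂ :=
  (spanningSets ν n).indicator V

theorem enorm_truncation_le [SigmaFinite ν] (V : Y → ℂ) (n : ℕ) (y : Y) :
    ‖truncation ν V n y‖ₑ ≤ ‖V y‖ₑ := enorm_indicator_le_enorm_self _ _

theorem memLp_truncation [SigmaFinite ν] {V : Y → ℂ} (hV : MemLp V 2 ν) (n : ℕ) :
    MemLp (truncation ν V n) 2 ν := hV.indicator (measurableSet_spanningSets ν n)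

theorem integrable_truncation [SigmaFinite ν] {V : Y → ℂ} (hV : MemLp V 2 ν) (n : ℕ) :
    Integrable (truncation ν V n) ν := by
  have : IsFiniteMeasure (ν.restrict (spanningSets ν n)) :=
    ⟨by rw [Measure.restrict_apply_univ]; exact measure_spanningSets_lt_top ν n⟩
  exact (integrable_indicator_iff (measurableSet_spanningSets ν n)).2
    ((hV.restrict _).integrable one_le_two)

theorem tendsto_truncation [SigmaFinite ν] (V : Y → ℂ) (y : Y) :
    ∀ᶠ n in atTop, truncation ν V n y = V y := by
  obtain ⟨N, hN⟩ := Set.mem_iUnion.1 ((iUnion_spanningSets ν).symm ▸ Set.mem_univ y)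
  filter_upwards [eventually_ge_atTop N] with n hn
  exact Set.indicator_of_mem (monotone_spanningSets ν hn hN) V

theorem tendsto_eLpNorm_truncation_sub [SigmaFinite ν] {V : Y → ℂ} (hV : MemLp V 2 ν) :
    Tendsto (fun n => eLpNorm (truncation ν V n - V) 2 ν) atTop (𝓝 0) := by
  have h : Tendsto (fun n => ∫⁻ y, ‖(truncation ν V n - V) y‖ₑ ^ 2 ∂ν) atTop (𝓝 (∫⁻ _, 0 ∂ν)) := by
    refine tendsto_lintegral_of_dominated_convergence' (fun y => ‖V y‖ₑ ^ 2)
      (fun n => ((memLp_truncation hV n).1.sub hV.1).enorm.pow_const 2)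
      (fun n => Eventually.of_forall fun y => ?_) ?_ (Eventually.of_forall fun y => ?_)
    · simp only [Pi.sub_apply, truncation]
      by_cases hy : y ∈ spanningSets ν n <;> simp [hy]
    · rw [← eLpNorm_two_sq]
      exact (ENNReal.pow_lt_top hV.2).ne
    · refine tendsto_const_nhds.congr' ?_
      filter_upwards [tendsto_truncation (ν := ν) V y] with n hn
      simp [hn]
  simp_rw [← eLpNorm_two_sq, lintegral_zero] at h
  have h2 := h.ennrpow_const (1 / 2)
  have hsqrt : ∀ x : ℝ≥0∞, (x ^ 2) ^ (1 / 2 : ℝ) = x := fun x => by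
    rw [← ENNReal.rpow_natCast, ← ENNReal.rpow_mul]; norm_num
  simp_rw [hsqrt] at h2
  rwa [ENNReal.zero_rpow_of_pos (by norm_num)] at h2

/-- The function `f` is the extension to `L²` of the transform `∫ e (x, y) V (y) dy`. -/
def IsL2Transform (e : X → Y → ℂ) (μ : Measure X) (ν : Measure Y) [SigmaFinite ν] (V : Y → ℂ)
    (f : X → ℂ) : Prop :=
  MemLp f 2 μ ∧
    Tendsto (fun n => eLpNorm (oscIntegral e ν (truncation ν V n) - f) 2 μ) atTop (𝓝 0)

/-- Truncations of V converge in L², and the Bessel inequality for their differences makes the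
transforms a Cauchy sequence. -/
theorem IsBesselKernel.exists_isL2Transform [SigmaFinite ν] (he : IsBesselKernel e μ ν C)
    {V : Y → ℂ} (hV : MemLp V 2 ν) : ∃ f, IsL2Transform e μ ν V f := by
  have hT : ∀ n, MemLp (oscIntegral e ν (truncation ν V n)) 2 μ := fun n =>
    ⟨(he.stronglyMeasurable_oscIntegral (memLp_truncation hV n).1).aestronglyMeasurable,
      (he.eLpNorm_le (integrable_truncation hV n)).trans_lt
        (ENNReal.mul_lt_top ENNReal.coe_lt_top (memLp_truncation hV n).2)⟩
  have hW : CauchySeq fun n => (memLp_truncation hV n).toLp (truncation ν V n) :=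
    ((Lp.tendsto_Lp_iff_tendsto_eLpNorm'' _ (memLp_truncation hV) V hV).2
      (tendsto_eLpNorm_truncation_sub hV)).cauchySeq
  have hF : CauchySeq fun n => (hT n).toLp (oscIntegral e ν (truncation ν V n)) := by
    rw [EMetric.cauchySeq_iff] at hW ⊢
    intro δ hδ
    have hK : (NNReal.sqrt C + 1 : ℝ≥0∞) ≠ ∞ := by finiteness
    obtain ⟨N, hN⟩ := hW (δ / (NNReal.sqrt C + 1)) (ENNReal.div_pos hδ.ne' hK)
    refine ⟨N, fun m hm n hn => ?_⟩
    have h := hN m hm n hn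
    rw [Lp.edist_toLp_toLp] at h ⊢
    rw [he.oscIntegral_sub (integrable_truncation hV m) (integrable_truncation hV n)]
    refine (he.eLpNorm_le ((integrable_truncation hV m).sub (integrable_truncation hV n))).trans_lt ?_
    refine lt_of_le_of_lt ?_ (ENNReal.mul_lt_of_lt_div' h)
    gcongr
    exact le_self_add
  obtain ⟨F, hFlim⟩ := cauchySeq_tendsto_of_complete hF
  refine ⟨F, Lp.memLp F, ?_⟩
  rw [← Lp.toLp_coeFn F (Lp.memLp F)] at hFlim
  exact (Lp.tendsto_Lp_iff_tendsto_eLpNorm'' _ hT _ (Lp.memLp F)).1 hFlim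

/-- The bilinear estimate for transforms. -/
theorem IsBesselKernel.lintegral_mul_sq_le [AddCommGroup Y] [MeasurableAdd₂ Y] [MeasurableSub₂ Y]
    [MeasurableNeg Y] [SFinite ν] [ν.IsAddLeftInvariant] (he : IsBesselKernel e μ ν C)
    (hadd : ∀ x y y', e x (y + y') = e x y * e x y') {a b : Y → ℝ≥0∞} (ha : Measurable a)
    (hb : Measurable b) (ha0 : ∀ y, a y ≠ 0) (ha1 : ∀ y, a y ≠ ∞) (hb0 : ∀ y, b y ≠ 0)
    (hb1 : ∀ y, b y ≠ ∞) {K : ℝ≥0∞} (hK : ∀ z, ∫⁻ y, (a (z - y) ^ 2 * b y ^ 2)⁻¹ ∂ν ≤ K)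
    {V W : Y → ℂ} (hV : Integrable V ν) (hW : Integrable W ν) :
    ∫⁻ x, ‖oscIntegral e ν V x * oscIntegral e ν W x‖ₑ ^ 2 ∂μ ≤
      C * (K * ((∫⁻ y, (a y * ‖V y‖ₑ) ^ 2 ∂ν) * ∫⁻ y, (b y * ‖W y‖ₑ) ^ 2 ∂ν)) := by
  wlog hm : StronglyMeasurable V ∧ StronglyMeasurable W generalizing V W
  · have hmV := hV.1.ae_eq_mk
    have hmW := hW.1.ae_eq_mk
    have := this (hV.congr hmV) (hW.congr hmW)
      ⟨hV.1.stronglyMeasurable_mk, hW.1.stronglyMeasurable_mk⟩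
    rw [← oscIntegral_congr_ae e hmV, ← oscIntegral_congr_ae e hmW] at this
    rwa [lintegral_congr_ae (hmV.mono fun y hy => by simp only [hy] :
        (fun y => (a y * ‖V y‖ₑ) ^ 2) =ᵐ[ν] fun y => (a y * ‖hV.1.mk V y‖ₑ) ^ 2),
      lintegral_congr_ae (hmW.mono fun y hy => by simp only [hy] :
        (fun y => (b y * ‖W y‖ₑ) ^ 2) =ᵐ[ν] fun y => (b y * ‖hW.1.mk W y‖ₑ) ^ 2)]
  have hint : Integrable (fun z : Y × Y => W z.2 * V (z.1 - z.2)) (ν.prod ν) :=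
    hW.convolution_integrand (ContinuousLinearMap.mul ℂ ℂ) hV
  set H : Y → ℂ := fun z => ∫ y, W y * V (z - y) ∂ν with hH
  have hHint : Integrable H ν := hint.integral_prod_left
  -- The convolution theorem: each `e x` is a character, so Fubini and the translation z ↦ z - y
  -- separate the variables.
  have hmul : ∀ x, oscIntegral e ν V x * oscIntegral e ν W x = oscIntegral e ν H x := fun x => by
    have h1 : Integrable (fun z : Y × Y => e x z.1 * (W z.2 * V (z.1 - z.2))) (ν.prod ν) :=
      hint.bdd_mul ((he.measurable_right x).comp measurable_fst).aestronglyMeasurable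
        (Eventually.of_forall fun z => (he.norm_eq x z.1).le)
    have h2 : oscIntegral e ν H x = ∫ z, ∫ y, e x z * (W y * V (z - y)) ∂ν ∂ν :=
      integral_congr_ae (Eventually.of_forall fun z => by
        simp only [hH]; rw [integral_const_mul])
    rw [h2, integral_integral_swap h1]
    have h3 : ∀ y, ∫ z, e x z * (W y * V (z - y)) ∂ν = e x y * W y * oscIntegral e ν V x :=
      fun y => by
      rw [oscIntegral, ← integral_const_mul,
        ← integral_sub_right_eq_self (fun z => e x y * W y * (e x z * V z)) y]
      refine integral_congr_ae (Eventually.of_forall fun z => ?_)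
      have := hadd x (z - y) y
      rw [sub_add_cancel] at this
      simp only [this]
      ring
    simp_rw [h3]
    rw [integral_mul_const, mul_comm]
    rfl
  simp_rw [hmul]
  refine (he.bessel H hHint).trans ?_
  refine mul_le_mul' le_rfl (le_trans (lintegral_mono fun z => ?_) (lintegral_conv_sq_le
    (F := fun y => ‖V y‖ₑ) (G := fun y => ‖W y‖ₑ) hm.1.measurable.enorm hm.2.measurable.enorm
    ha hb ha0 ha1 hb0 hb1 hK))
  gcongr
  refine (enorm_integral_le_lintegral_enorm _).trans (lintegral_mono fun y => ?_)
  rw [enorm_mul, mul_comm]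

/-- Truncation does not increase weighted norms, so the integrable case bounds all truncated
products uniformly. L² convergence gives convergence almost everywhere along a subsequence, and
Fatou's lemma concludes. -/
theorem IsBesselKernel.eLpNorm_mul_le [AddCommGroup Y] [MeasurableAdd₂ Y] [MeasurableSub₂ Y]
    [MeasurableNeg Y] [SigmaFinite ν] [ν.IsAddLeftInvariant] (he : IsBesselKernel e μ ν C)
    (hadd : ∀ x y y', e x (y + y') = e x y * e x y') {a b : Y → ℝ} (ha : Measurable a)
    (hb : Measurable b) (ha0 : ∀ y, 0 < a y) (hb0 : ∀ y, 0 < b y) {K : ℝ≥0}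
    (hK : ∀ z, ∫⁻ y, (ENNReal.ofReal (a (z - y)) ^ 2 * ENNReal.ofReal (b y) ^ 2)⁻¹ ∂ν ≤ K)
    {V W : Y → ℂ} (hV : MemLp V 2 ν) (hW : MemLp W 2 ν)
    (haV : MemLp (fun y => (a y : ℂ) * V y) 2 ν) (hbW : MemLp (fun y => (b y : ℂ) * W y) 2 ν)
    {f g : X → ℂ} (hf : IsL2Transform e μ ν V f) (hg : IsL2Transform e μ ν W g) :
    eLpNorm (fun x => f x * g x) 2 μ ≤ NNReal.sqrt (C * K) *
      (eLpNorm (fun y => (a y : ℂ) * V y) 2 ν * eLpNorm (fun y => (b y : ℂ) * W y) 2 ν) := by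
  set T : (Y → ℂ) → ℕ → X → ℂ := fun V n => oscIntegral e ν (truncation ν V n) with hT
  have hTm : ∀ {V} (_ : MemLp V 2 ν) n, AEStronglyMeasurable (T V n) μ := fun hV n =>
    (he.stronglyMeasurable_oscIntegral (memLp_truncation hV n).1).aestronglyMeasurable
  obtain ⟨ns, hns, hfns⟩ := (tendstoInMeasure_of_tendsto_eLpNorm two_ne_zero (hTm hV) hf.1.1
    hf.2).exists_seq_tendsto_ae
  -- The second subsequence is extracted from the first, so that both factors converge along `ns ∘
  -- ms`.
  obtain ⟨ms, hms, hgms⟩ := (tendstoInMeasure_of_tendsto_eLpNorm two_ne_zero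
    (fun n => hTm hW (ns n)) hg.1.1 (hg.2.comp hns.tendsto_atTop)).exists_seq_tendsto_ae
  have hbound : ∀ n, eLpNorm (fun x => T V n x * T W n x) 2 μ ≤ NNReal.sqrt (C * K) *
      (eLpNorm (fun y => (a y : ℂ) * V y) 2 ν * eLpNorm (fun y => (b y : ℂ) * W y) 2 ν) := by
    intro n
    rw [← ENNReal.pow_le_pow_left_iff two_ne_zero, mul_pow, mul_pow, eLpNorm_two_sq,
      eLpNorm_two_sq, eLpNorm_two_sq, ← ENNReal.coe_pow, NNReal.sq_sqrt]
    refine (he.lintegral_mul_sq_le hadd (a := fun y => ENNReal.ofReal (a y))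
      (b := fun y => ENNReal.ofReal (b y)) (by fun_prop) (by fun_prop)
      (fun y => (ENNReal.ofReal_pos.2 (ha0 y)).ne') (fun y => ENNReal.ofReal_ne_top)
      (fun y => (ENNReal.ofReal_pos.2 (hb0 y)).ne') (fun y => ENNReal.ofReal_ne_top) hK
      (integrable_truncation hV n) (integrable_truncation hW n)).trans ?_
    have hen : ∀ {c : Y → ℝ} (_ : ∀ y, 0 < c y) (U : Y → ℂ) y,
        ENNReal.ofReal (c y) * ‖truncation ν U n y‖ₑ ≤ ‖(c y : ℂ) * U y‖ₑ := fun {c} hc U y => by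
      have hcy : ‖(c y : ℂ)‖ₑ = ENNReal.ofReal (c y) := by
        rw [← ofReal_norm, Complex.norm_real, Real.norm_of_nonneg (hc y).le]
      rw [enorm_mul, hcy]
      gcongr
      exact enorm_truncation_le U n y
    push_cast
    rw [mul_assoc]
    gcongr
    · exact hen ha0 V _
    · exact hen hb0 W _
  have hfin : (NNReal.sqrt (C * K) : ℝ≥0∞) * (eLpNorm (fun y => (a y : ℂ) * V y) 2 ν *
      eLpNorm (fun y => (b y : ℂ) * W y) 2 ν) ≠ ∞ :=
    ENNReal.mul_ne_top ENNReal.coe_ne_top (ENNReal.mul_ne_top haV.2.ne hbW.2.ne)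
  refine Lp.eLpNorm_le_of_ae_tendsto (u := atTop)
    (f := fun n x => T V (ns (ms n)) x * T W (ns (ms n)) x)
    (Eventually.of_forall fun n => hbound _)
    (fun n => (hTm hV _).mul (hTm hW _)) ?_
  filter_upwards [hfns, hgms] with x h1 h2
  exact (h1.comp hms.tendsto_atTop).mul h2

end Kernel

/-! ### Bessel inequalities on the line and on the circle -/

/-- The kernel `exp (i x y)` on the line. -/
def lineChar (x y : ℝ) : ℂ := Complex.exp (Complex.I * ((x * y : ℝ) : ℂ))

/-- The kernel `exp (i x k)` on the circle. -/
def circChar (x : Circ) (k : ℤ) : ℂ := fourier k x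

theorem norm_lineChar (x y : ℝ) : ‖lineChar x y‖ = 1 := by
  rw [lineChar, mul_comm, Complex.norm_exp_ofReal_mul_I]

theorem lineChar_add (x y y' : ℝ) : lineChar x (y + y') = lineChar x y * lineChar x y' := by
  simp only [lineChar]
  rw [← Complex.exp_add]
  push_cast
  ring_nf

theorem norm_circChar (x : Circ) (k : ℤ) : ‖circChar x k‖ = 1 := by
  rw [circChar, fourier_apply, Circle.norm_coe]

theorem circChar_add (x : Circ) (k k' : ℤ) :
    circChar x (k + k') = circChar x k * circChar x k' := fourier_add

theorem circChar_coe (x : ℝ) (k : ℤ) : circChar (x : Circ) k = lineChar x k := by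
  rw [circChar, fourier_coe_apply, lineChar]
  congr 1
  have : (Real.pi : ℂ) ≠ 0 := by exact_mod_cast Real.pi_ne_zero
  push_cast
  field_simp

theorem oscIntegral_lineChar (V : ℝ → ℂ) (x : ℝ) :
    oscIntegral lineChar volume V x = 𝓕 V (-(2 * Real.pi)⁻¹ * x) := by
  rw [Real.fourier_eq', oscIntegral]
  refine integral_congr_ae (Eventually.of_forall fun y => ?_)
  simp only [lineChar, smul_eq_mul]
  congr 2
  have : (Real.pi : ℂ) ≠ 0 := by exact_mod_cast Real.pi_ne_zero
  simp
  field_simp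

/-- Plancherel's theorem for functions in `L¹ ∩ L²`. -/
theorem eLpNorm_fourier_eq {V : ℝ → ℂ} (h1 : Integrable V) (h2 : MemLp V 2) :
    eLpNorm (𝓕 V) 2 volume = eLpNorm V 2 volume := by
  set G : Lp ℂ 2 (volume : Measure ℝ) := 𝓕 (h2.toLp V)
  have hcont : Continuous (𝓕 V) :=
    VectorFourier.fourierIntegral_continuous Real.continuous_fourierChar
      (by exact continuous_inner) h1
  -- The Fourier integral and the L² Fourier transform have the same pairing with every smooth
  -- compactly supported g: both equal the integral of V against the Fourier transform of g.
  have hG : 𝓕 V =ᵐ[volume] G := by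
    have : ∀ᵐ x, (𝓕 V - (G : ℝ → ℂ)) x = 0 := by
      have hGloc : LocallyIntegrable (G : ℝ → ℂ) := (Lp.memLp G).locallyIntegrable one_le_two
      refine ae_eq_zero_of_integral_contDiff_smul_eq_zero
        (hcont.locallyIntegrable.sub hGloc) fun g hg hgc => ?_
      have hg₁ : HasCompactSupport (Complex.ofRealCLM ∘ g) := hgc.comp_left rfl
      have hg₂ : ContDiff ℝ ((⊤ : ℕ∞) : WithTop ℕ∞) (Complex.ofRealCLM ∘ g) := by fun_prop
      set φ : 𝓢(ℝ, ℂ) := hg₁.toSchwartzMap hg₂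
      have hφ : ∀ x, φ x = (g x : ℂ) := fun x => rfl
      have e1 : ∫ x, g x • 𝓕 V x = ∫ x, 𝓕 (φ : ℝ → ℂ) x • V x := by
        have := VectorFourier.integral_fourierIntegral_smul_eq_flip (μ := volume) (ν := volume)
          (L := innerₗ ℝ) Real.continuous_fourierChar (by exact continuous_inner)
          (φ.integrable (μ := volume)) h1
        rw [flip_innerₗ] at this
        refine Eq.trans ?_ this.symm
        rfl
      have e2 : ∫ x, g x • (G : ℝ → ℂ) x = ∫ x, 𝓕 (φ : ℝ → ℂ) x • V x := by
        have h3 : (𝓕 (Lp.toTemperedDistribution (h2.toLp V))) φ = Lp.toTemperedDistribution G φ := by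
          rw [Lp.fourier_toTemperedDistribution_eq]
        rw [TemperedDistribution.fourier_apply, Lp.toTemperedDistribution_apply,
          Lp.toTemperedDistribution_apply] at h3
        refine Eq.trans ?_ (h3.symm.trans (integral_congr_ae ?_))
        · rfl
        · filter_upwards [h2.coeFn_toLp] with x hx
          rw [hx]
          rfl
      have i1 : Integrable fun x => g x • 𝓕 V x :=
        (hcont.locallyIntegrable).integrable_smul_left_of_hasCompactSupport hg.continuous hgc
      have i2 : Integrable fun x => g x • (G : ℝ → ℂ) x :=
        hGloc.integrable_smul_left_of_hasCompactSupport hg.continuous hgc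
      simp only [Pi.sub_apply, smul_sub]
      rw [integral_sub i1 i2, e1, e2, sub_self]
    exact this.mono fun x hx => sub_eq_zero.1 hx
  rw [eLpNorm_congr_ae hG, ← Lp.enorm_def, ← Lp.enorm_toLp h2, ← ofReal_norm, ← ofReal_norm,
    Lp.norm_fourier_eq]

theorem isBesselKernel_lineChar :
    IsBesselKernel lineChar volume volume (2 * Real.pi).toNNReal where
  measurable := by
    have : Continuous fun p : ℝ × ℝ => Complex.exp (Complex.I * ((p.1 * p.2 : ℝ) : ℂ)) := by
      fun_prop
    exact this.measurable
  norm_eq := norm_lineChar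
  bessel V hV := by
    have hpi := Real.two_pi_pos
    by_cases h2 : MemLp V 2
    · have hc : -(2 * Real.pi)⁻¹ ≠ 0 := neg_ne_zero.2 (inv_ne_zero hpi.ne')
      have hcont : Continuous (𝓕 V) :=
        VectorFourier.fourierIntegral_continuous Real.continuous_fourierChar
          (by exact continuous_inner) hV
      simp_rw [oscIntegral_lineChar]
      rw [← lintegral_map (f := fun x => ‖𝓕 V x‖ₑ ^ 2) (g := fun x => -(2 * Real.pi)⁻¹ * x)
        (hcont.measurable.enorm.pow_const 2) (by fun_prop), Real.map_volume_mul_left hc,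
        lintegral_smul_measure, ← eLpNorm_two_sq, ← eLpNorm_two_sq, eLpNorm_fourier_eq hV h2,
        inv_neg, inv_inv, abs_neg, abs_of_pos hpi, smul_eq_mul]
      rfl
    -- If V is not in L², the right-hand side is infinite.
    · have : eLpNorm V 2 volume = ∞ := by
        by_contra h
        exact h2 ⟨hV.1, lt_top_iff_ne_top.2 h⟩
      rw [← eLpNorm_two_sq, ← eLpNorm_two_sq, this, ENNReal.top_pow two_ne_zero,
        ENNReal.mul_top (by simpa using hpi)]
      exact le_top

/-- Parseval: for summable V the Fourier series converges uniformly, and its class in L² has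
coefficients V. The constant 2π is the ratio of the volume to the Haar probability measure. -/
theorem isBesselKernel_circChar :
    IsBesselKernel circChar volume Measure.count (2 * Real.pi).toNNReal where
  measurable := by
    refine measurable_from_prod_countable_left fun k => ?_
    exact (fourier k).continuous.measurable
  norm_eq := norm_circChar
  bessel V hV := by
    rw [integrable_count_iff] at hV
    have hVn : Summable fun k => ‖V k‖ := hV
    have hsum : Summable fun k : ℤ => V k • (fourier k : C(Circ, ℂ)) :=
      .of_norm (by simpa [norm_smul, fourier_norm] using hVn)
    set f : C(Circ, ℂ) := ∑' k, V k • fourier k with hf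
    have hosc : ∀ x, oscIntegral circChar Measure.count V x = f x := fun x => by
      have h1 : Integrable (fun k => circChar x k * V k) Measure.count := by
        rw [integrable_count_iff]
        refine .of_norm ?_
        simpa [norm_circChar] using hVn
      rw [oscIntegral, integral_countable h1, hf, ← ContinuousMap.tsum_apply hsum]
      refine tsum_congr fun k => ?_
      simp [circChar, mul_comm]
    have hmem : Memℓp V 2 :=
      (memℓp_gen (p := 1) (by simpa using hVn)).of_exponent_ge one_le_two
    set v : lp (fun _ : ℤ => ℂ) 2 := ⟨V, hmem⟩
    have hF : ContinuousMap.toLp 2 AddCircle.haarAddCircle ℂ f = fourierBasis.repr.symm v := by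
      have h1 := (hsum.hasSum).mapL
        (ContinuousMap.toLp (E := ℂ) 2 (AddCircle.haarAddCircle (T := 2 * Real.pi)) ℂ)
      have h2 := (fourierBasis (T := 2 * Real.pi)).hasSum_repr_symm v
      refine h1.unique ?_
      convert! h2 using 2 with k
      simp [coe_fourierBasis, fourierLp, v]
    have hnorm : ‖ContinuousMap.toLp 2 (AddCircle.haarAddCircle (T := 2 * Real.pi)) ℂ f‖ ^ 2 =
        ∑' k, ‖V k‖ ^ 2 := by
      rw [hF, LinearIsometryEquiv.norm_map]
      have := lp.norm_rpow_eq_tsum (p := 2) (by norm_num) v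
      simpa using this
    have hS : Summable fun k => ‖V k‖ ^ 2 := by
      simpa using (memℓp_gen_iff (p := 2) (by norm_num)).1 hmem
    have henorm : ∫⁻ x, ‖f x‖ₑ ^ 2 ∂(AddCircle.haarAddCircle (T := 2 * Real.pi)) =
        ∑' k, ‖V k‖ₑ ^ 2 := by
      rw [← eLpNorm_two_sq, ← eLpNorm_congr_ae (ContinuousMap.coeFn_toLp (𝕜 := ℂ) (p := 2) _ f),
        ← Lp.enorm_def, ← ofReal_norm, ← ENNReal.ofReal_pow (norm_nonneg _), hnorm,
        ENNReal.ofReal_tsum_of_nonneg (fun k => by positivity) hS]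
      refine tsum_congr fun k => ?_
      rw [ENNReal.ofReal_pow (norm_nonneg _), ofReal_norm]
    simp_rw [hosc]
    rw [AddCircle.volume_eq_smul_haarAddCircle, lintegral_smul_measure, henorm, lintegral_count]
    rfl

/-! ### Functions on a quotient of the plane as distributions -/

/-- A measurable map `proj : ℝ → A` which preserves and reflects null sets and for which the
lift of an integrable function is integrable against the weight `⟨x⟩ ^ (-2)`. -/
structure IsCover {A : Type*} [MeasureSpace A] (proj : ℝ → A) : Prop where
  measurable : Measurable proj
  exists_bound : ∃ M : ℝ≥0, ∀ F : A → ℝ≥0∞, Measurable F →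
    ∫⁻ x, F (proj x) * ENNReal.ofReal (bracket x ^ (-2 : ℝ)) ≤ M * ∫⁻ a, F a
  absolutelyContinuous : (volume : Measure A) ≪ Measure.map proj volume

theorem isCover_id : IsCover (id : ℝ → ℝ) where
  measurable := measurable_id
  exists_bound := by
    refine ⟨1, fun F _ => ?_⟩
    rw [ENNReal.coe_one, one_mul]
    refine lintegral_mono fun x => mul_le_of_le_one_right' ?_
    rw [← ENNReal.ofReal_one]
    exact ENNReal.ofReal_le_ofReal
      (Real.rpow_le_one_of_one_le_of_nonpos (one_le_bracket x) (by norm_num))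
  absolutelyContinuous := by rw [Measure.map_id]

theorem isCover_circ : IsCover ((↑) : ℝ → Circ) where
  measurable := AddCircle.measurable_mk'
  exists_bound := by
    have hpi := Real.two_pi_pos
    obtain ⟨C, hC⟩ := bracketBound_count_int.sub one_lt_two
    have hC0 := hC 0
    rw [lintegral_map (by fun_prop) (by fun_prop), lintegral_count] at hC0
    refine ⟨4 * C, fun F hF => ?_⟩
    have hmeas : Measurable fun x : ℝ => F (x : Circ) := hF.comp AddCircle.measurable_mk'
    have hun : (⋃ k : ℤ, Set.Ioc (k • (2 * Real.pi)) ((k + 1) • (2 * Real.pi))) = Set.univ :=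
      iUnion_Ioc_zsmul hpi
    rw [← setLIntegral_univ, ← hun, lintegral_iUnion (fun k => measurableSet_Ioc)
      (Set.pairwise_disjoint_Ioc_zsmul (2 * Real.pi))]
    calc _ ≤ ∑' k : ℤ, (4 * ENNReal.ofReal (bracket ((k : ℝ) - 0) ^ (-2 : ℝ))) * ∫⁻ a, F a := by
          refine ENNReal.tsum_le_tsum fun k => ?_
          calc _ ≤ ∫⁻ x in Set.Ioc (k • (2 * Real.pi)) ((k + 1) • (2 * Real.pi)),
                F (x : Circ) * (4 * ENNReal.ofReal (bracket ((k : ℝ) - 0) ^ (-2 : ℝ))) := by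
                refine setLIntegral_mono (by fun_prop) fun x hx => ?_
                gcongr
                rw [show (4 : ℝ≥0∞) = ENNReal.ofReal 4 by norm_num,
                  ← ENNReal.ofReal_mul (by norm_num), sub_zero]
                refine ENNReal.ofReal_le_ofReal ?_
                -- The factor 2 is needed at k = -1, whose interval contains 0.
                have h1 : bracket (k : ℝ) ≤ 2 * bracket x := by
                  simp only [zsmul_eq_mul, Int.cast_add, Int.cast_one, Set.mem_Ioc] at hx
                  have h3 := Real.pi_gt_three
                  unfold bracket
                  have hx1 := le_abs_self x
                  have hx2 := neg_abs_le x
                  rcases le_or_gt 0 (k : ℝ) with hk | hk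
                  · rw [abs_of_nonneg hk]
                    nlinarith
                  · have hk1 : (k : ℝ) ≤ -1 := by
                      have : k ≤ -1 := by
                        have : k < 0 := by exact_mod_cast hk
                        omega
                      exact_mod_cast this
                    rw [abs_of_neg hk]
                    nlinarith
                have h2 := rpow_neg_le_of_le_mul (bracket_pos _) (bracket_pos _) two_pos
                  (by norm_num : (0 : ℝ) ≤ 2) h1
                norm_num at h2 ⊢
                exact h2
            _ = (4 * ENNReal.ofReal (bracket ((k : ℝ) - 0) ^ (-2 : ℝ))) * ∫⁻ a, F a := by
                rw [lintegral_mul_const _ hmeas, mul_comm, add_zsmul, one_zsmul,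
                  AddCircle.lintegral_preimage]
      _ ≤ _ := by
          rw [ENNReal.tsum_mul_right, ENNReal.tsum_mul_left]
          push_cast
          gcongr
  absolutelyContinuous := by
    rw [← (AddCircle.measurePreserving_mk (2 * Real.pi) 0).map_eq]
    exact Measure.absolutelyContinuous_of_le
      (Measure.map_mono Measure.restrict_le_self AddCircle.measurable_mk')

section Cover

variable {A : Type*} [MeasureSpace A] {proj : ℝ → A}

/-- The projection of the plane in the second variable. -/
def planeProj (proj : ℝ → A) (z : ℝ × ℝ) : ℝ × A := (z.1, proj z.2)

theorem IsCover.measurable_planeProj (hp : IsCover proj) : Measurable (planeProj proj) := by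
  have := hp.measurable
  unfold planeProj
  fun_prop

/-- The bound in `IsCover` is applied to the indicator of a null set; the weight never vanishes. -/
theorem IsCover.map_absolutelyContinuous (hp : IsCover proj) :
    Measure.map proj volume ≪ (volume : Measure A) := by
  refine Measure.AbsolutelyContinuous.mk fun s hs h0 => ?_
  obtain ⟨M, hM⟩ := hp.exists_bound
  have h1 := hM (s.indicator 1) (measurable_one.indicator hs)
  have hm : Measurable fun x =>
      s.indicator (1 : A → ℝ≥0∞) (proj x) * ENNReal.ofReal (bracket x ^ (-2 : ℝ)) :=
    ((measurable_one.indicator hs).comp hp.measurable).mul (by fun_prop)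
  rw [lintegral_indicator_one hs, h0, mul_zero, nonpos_iff_eq_zero,
    lintegral_eq_zero_iff hm] at h1
  rw [Measure.map_apply hp.measurable hs]
  refine measure_mono_null (fun x hx => ?_) h1
  have h2 : ENNReal.ofReal (bracket x ^ (-2 : ℝ)) ≠ 0 :=
    (ENNReal.ofReal_pos.2 (Real.rpow_pos_of_pos (bracket_pos x) _)).ne'
  have h3 : s.indicator (1 : A → ℝ≥0∞) (proj x) = 1 := Set.indicator_of_mem hx 1
  change ¬(_ * _ = _)
  rw [h3, one_mul]
  exact h2

variable [SFinite (volume : Measure A)]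

theorem IsCover.quasiMeasurePreserving (hp : IsCover proj) :
    Measure.QuasiMeasurePreserving (planeProj proj) volume volume := by
  refine ⟨hp.measurable_planeProj, ?_⟩
  have h := Measure.map_prod_map (volume : Measure ℝ) (volume : Measure ℝ) measurable_id
    hp.measurable
  rw [Measure.map_id] at h
  change Measure.map (Prod.map id proj) _ ≪ _
  rw [Measure.volume_eq_prod, ← h]
  exact Measure.AbsolutelyContinuous.rfl.prod hp.map_absolutelyContinuous

theorem IsCover.ae_eq_zero_of_comp (hp : IsCover proj) {g : ℝ × A → ℂ}
    (hg : AEStronglyMeasurable g volume) (h : ∀ᵐ z, g (planeProj proj z) = 0) :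
    g =ᵐ[volume] 0 := by
  have hac : (volume : Measure (ℝ × A)) ≪ Measure.map (planeProj proj) volume := by
    have h := Measure.map_prod_map (volume : Measure ℝ) (volume : Measure ℝ) measurable_id
      hp.measurable
    rw [Measure.map_id] at h
    change _ ≪ Measure.map (Prod.map id proj) _
    rw [Measure.volume_eq_prod, Measure.volume_eq_prod, ← h]
    have : SFinite (Measure.map proj (volume : Measure ℝ)) := inferInstance
    exact Measure.AbsolutelyContinuous.rfl.prod hp.absolutelyContinuous
  have hmk : ∀ᵐ x ∂Measure.map (planeProj proj) volume, hg.mk g x = 0 := by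
    rw [ae_map_iff (p := fun x => hg.mk g x = 0) hp.measurable_planeProj.aemeasurable
      (hg.stronglyMeasurable_mk.measurable (measurableSet_singleton 0))]
    filter_upwards [h, hp.quasiMeasurePreserving.ae_eq_comp hg.ae_eq_mk] with z h1 h2
    simp only [Function.comp_apply] at h2
    rw [← h2, h1]
  exact hg.ae_eq_mk.trans (hac.ae_le hmk)

/-- Lifts of square integrable functions can be paired with Schwartz functions. -/
theorem IsCover.exists_lintegral_le (hp : IsCover proj) (φ : 𝓢(ℝ × ℝ, ℂ)) :
    ∃ M : ℝ≥0, ∀ F : ℝ × A → ℂ, AEStronglyMeasurable F volume →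
      ∫⁻ z, ‖F (planeProj proj z) * φ z‖ₑ ≤ M * eLpNorm F 2 volume := by
  obtain ⟨M, hM⟩ := hp.exists_bound
  set I : ℝ≥0∞ := ∫⁻ z, (‖φ z‖ₑ * ENNReal.ofReal (bracket z.2)) ^ 2 with hI
  have hIfin : I ≠ ∞ := by
    -- One power absorbs the bracket; squaring the other two gives decay of order 4, integrable in
    -- the plane.
    obtain ⟨c, hc0, hc⟩ : ∃ c : ℝ, 0 ≤ c ∧ ∀ z, (1 + ‖z‖) ^ 3 * ‖φ z‖ ≤ c := by
      have := fun z => φ.one_add_le_sup_seminorm_apply (𝕜 := ℂ) (m := (3, 0)) le_rfl le_rfl z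
      simp only [norm_iteratedFDeriv_zero] at this
      exact ⟨_, (by positivity : 0 ≤ (1 + ‖(0 : ℝ × ℝ)‖) ^ 3 * ‖φ 0‖).trans (this 0), this⟩
    have hint : Integrable (fun z : ℝ × ℝ => c ^ 2 * (1 + ‖z‖) ^ (-(4 : ℝ))) :=
      (integrable_one_add_norm (by simp; norm_num)).const_mul _
    refine ne_top_of_le_ne_top hint.lintegral_lt_top.ne (lintegral_mono fun z => ?_)
    have hb : bracket z.2 ≤ 1 + ‖z‖ := by
      unfold bracket
      exact add_le_add_right (norm_snd_le z) 1
    have hb0 := bracket_pos z.2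
    rw [← ofReal_norm, ← ENNReal.ofReal_mul (norm_nonneg _), ← ENNReal.ofReal_pow (by positivity)]
    refine ENNReal.ofReal_le_ofReal ?_
    have hz : 0 < 1 + ‖z‖ := by positivity
    rw [Real.rpow_neg hz.le, ← div_eq_mul_inv, le_div_iff₀ (by positivity)]
    have e : (1 + ‖z‖) ^ (4 : ℝ) = ((1 + ‖z‖) ^ 2) ^ 2 := by norm_cast; ring
    rw [e, ← mul_pow]
    refine pow_le_pow_left₀ (by positivity) ?_ 2
    calc ‖φ z‖ * bracket z.2 * (1 + ‖z‖) ^ 2 ≤ ‖φ z‖ * (1 + ‖z‖) * (1 + ‖z‖) ^ 2 := by gcongr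
      _ = (1 + ‖z‖) ^ 3 * ‖φ z‖ := by ring
      _ ≤ c := hc z
  refine ⟨NNReal.sqrt (M * I.toNNReal), fun F hF => ?_⟩
  wlog hFm : StronglyMeasurable F generalizing F
  · have h := this (hF.mk F) hF.stronglyMeasurable_mk.aestronglyMeasurable hF.stronglyMeasurable_mk
    rw [eLpNorm_congr_ae hF.ae_eq_mk]
    refine le_of_eq_of_le (lintegral_congr_ae ?_) h
    filter_upwards [hp.quasiMeasurePreserving.ae_eq_comp hF.ae_eq_mk] with z hz
    simp only [Function.comp_apply] at hz
    rw [hz]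
  have hFm' := hFm.measurable
  have hπ := hp.measurable_planeProj
  have hφ : Measurable φ := φ.continuous.measurable
  have hFπ : Measurable fun z => F (planeProj proj z) := hFm'.comp hπ
  rw [← ENNReal.pow_le_pow_left_iff two_ne_zero, mul_pow, ← ENNReal.coe_pow, NNReal.sq_sqrt,
    eLpNorm_two_sq, ENNReal.coe_mul, ENNReal.coe_toNNReal hIfin]
  have hsplit : ∀ z : ℝ × ℝ, ‖F (planeProj proj z) * φ z‖ₑ =
      (‖F (planeProj proj z)‖ₑ * ENNReal.ofReal (bracket z.2)⁻¹) *
        (‖φ z‖ₑ * ENNReal.ofReal (bracket z.2)) := fun z => by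
    have hb := bracket_pos z.2
    rw [enorm_mul, mul_mul_mul_comm, mul_comm (ENNReal.ofReal _) (ENNReal.ofReal _), mul_assoc,
      ← ENNReal.ofReal_mul hb.le, mul_inv_cancel₀ hb.ne', ENNReal.ofReal_one, mul_one]
  simp_rw [hsplit]
  refine (lintegral_mul_sq_le (by fun_prop) (by fun_prop)).trans ?_
  rw [mul_right_comm]
  gcongr
  have hw : ∀ x : ℝ, ENNReal.ofReal (bracket x)⁻¹ ^ 2 = ENNReal.ofReal (bracket x ^ (-2 : ℝ)) :=
    fun x => by
    have hb := bracket_pos x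
    rw [← ENNReal.ofReal_pow (by positivity), Real.rpow_neg hb.le]
    norm_num
  simp_rw [mul_pow, hw]
  rw [Measure.volume_eq_prod, lintegral_prod _ (by fun_prop), Measure.volume_eq_prod,
    lintegral_prod _ (by fun_prop), ← lintegral_const_mul' _ _ ENNReal.coe_ne_top]
  exact lintegral_mono fun t => hM (fun a => ‖F (t, a)‖ₑ ^ 2) (by fun_prop)

theorem IsCover.integrable_mul (hp : IsCover proj) {F : ℝ × A → ℂ} (hF : MemLp F 2 volume)
    (φ : 𝓢(ℝ × ℝ, ℂ)) : Integrable fun z => F (planeProj proj z) * φ z := by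
  obtain ⟨M, hM⟩ := hp.exists_lintegral_le φ
  exact ⟨(hF.1.comp_quasiMeasurePreserving hp.quasiMeasurePreserving).mul
    φ.continuous.aestronglyMeasurable,
    (hM F hF.1).trans_lt (ENNReal.mul_lt_top ENNReal.coe_lt_top hF.2)⟩

/-- A square integrable function is determined by the distribution which it defines. -/
theorem IsCover.ae_eq_of_forall_integral_eq (hp : IsCover proj) {f f' : ℝ × A → ℂ}
    (hf : MemLp f 2 volume) (hf' : MemLp f' 2 volume)
    (h : ∀ φ : 𝓢(ℝ × ℝ, ℂ), ∫ z, f (planeProj proj z) * φ z = ∫ z, f' (planeProj proj z) * φ z) :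
    f =ᵐ[volume] f' := by
  have hg : MemLp (f - f') 2 volume := hf.sub hf'
  have htest : ∀ (g : ℝ × ℝ → ℝ) (_ : ContDiff ℝ ((⊤ : ℕ∞) : WithTop ℕ∞) g)
      (_ : HasCompactSupport g), ∃ φ : 𝓢(ℝ × ℝ, ℂ), ∀ z, φ z = (g z : ℂ) := fun g hg hgc => by
    have hg₁ : HasCompactSupport (Complex.ofRealCLM ∘ g) := hgc.comp_left rfl
    have hg₂ : ContDiff ℝ ((⊤ : ℕ∞) : WithTop ℕ∞) (Complex.ofRealCLM ∘ g) := by fun_prop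
    exact ⟨hg₁.toSchwartzMap hg₂, fun z => rfl⟩
  -- A bump function equal to 1 near z reduces local integrability to integrability against a
  -- Schwartz function.
  have hloc : LocallyIntegrable (fun z => (f - f') (planeProj proj z)) volume := fun z => by
    let b : ContDiffBump z := ⟨1, 2, one_pos, one_lt_two⟩
    obtain ⟨φ, hφ⟩ := htest b b.contDiff b.hasCompactSupport
    refine ⟨Metric.closedBall z 1, Metric.closedBall_mem_nhds z one_pos, ?_⟩
    refine ((hp.integrable_mul hg φ).integrableOn (s := Metric.closedBall z 1)).congr_fun
      (fun y hy => ?_) Metric.isClosed_closedBall.measurableSet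
    simp only [hφ, b.one_of_mem_closedBall hy, Complex.ofReal_one, mul_one]
  have hzero : ∀ᵐ z, (f - f') (planeProj proj z) = 0 := by
    refine ae_eq_zero_of_integral_contDiff_smul_eq_zero hloc fun g hg hgc => ?_
    obtain ⟨φ, hφ⟩ := htest g hg hgc
    have h1 : ∀ z, g z • (f - f') (planeProj proj z) =
        f (planeProj proj z) * φ z - f' (planeProj proj z) * φ z := fun z => by
      rw [hφ, Complex.real_smul, Pi.sub_apply]; ring
    simp_rw [h1]
    rw [integral_sub (hp.integrable_mul hf φ) (hp.integrable_mul hf' φ), h, sub_self]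
  exact (hp.ae_eq_zero_of_comp hg.1 hzero).mono fun x hx => sub_eq_zero.1 hx

/-- The transpose of the transform, applied to a test function on the plane. -/
def testTransform {Y : Type*} (e : ℝ × A → Y → ℂ) (proj : ℝ → A) (φ : ℝ × ℝ → ℂ) (y : Y) : ℂ :=
  ∫ z, e (planeProj proj z) y * φ z

/-- The distribution defined by the transform of `V`. -/
theorem IsL2Transform.integral_mul {Y : Type*} [MeasurableSpace Y] {ν : Measure Y} [SigmaFinite ν]
    {e : ℝ × A → Y → ℂ} {C : ℝ≥0} (he : IsBesselKernel e volume ν C) (hp : IsCover proj)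
    {V : Y → ℂ} (hV : MemLp V 2 ν) {f : ℝ × A → ℂ} (hf : IsL2Transform e volume ν V f)
    (φ : 𝓢(ℝ × ℝ, ℂ))
    (hVφ : Integrable (fun y => V y * testTransform e proj φ y) ν) :
    ∫ z, f (planeProj proj z) * φ z = ∫ y, V y * testTransform e proj φ y ∂ν := by
  have hT : ∀ n, MemLp (oscIntegral e ν (truncation ν V n)) 2 volume := fun n =>
    ⟨(he.stronglyMeasurable_oscIntegral (memLp_truncation hV n).1).aestronglyMeasurable,
      (he.eLpNorm_le (integrable_truncation hV n)).trans_lt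
        (ENNReal.mul_lt_top ENNReal.coe_lt_top (memLp_truncation hV n).2)⟩
  have hswap : ∀ n, ∫ z, oscIntegral e ν (truncation ν V n) (planeProj proj z) * φ z =
      ∫ y, truncation ν V n y * testTransform e proj φ y ∂ν := fun n => by
    have hint : Integrable (fun p : (ℝ × ℝ) × Y =>
        e (planeProj proj p.1) p.2 * (φ p.1 * truncation ν V n p.2)) (volume.prod ν) := by
      refine ((φ.integrable (μ := volume)).mul_prod (integrable_truncation hV n)).bdd_mul (c := 1)
        ?_ (Eventually.of_forall fun p => (he.norm_eq _ _).le)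
      have := hp.measurable_planeProj
      exact (he.measurable.comp (g := Function.uncurry e)
        (f := fun p : (ℝ × ℝ) × Y => (planeProj proj p.1, p.2)) (by fun_prop)).aestronglyMeasurable
    calc _ = ∫ z, ∫ y, e (planeProj proj z) y * (φ z * truncation ν V n y) ∂ν := by
          refine integral_congr_ae (Eventually.of_forall fun z => ?_)
          simp only [oscIntegral]
          rw [← integral_mul_const]
          refine integral_congr_ae (Eventually.of_forall fun y => ?_)
          simp only
          ring
      _ = ∫ y, (∫ z, e (planeProj proj z) y * (φ z * truncation ν V n y)) ∂ν :=
          integral_integral_swap hint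
      _ = _ := by
          refine integral_congr_ae (Eventually.of_forall fun y => ?_)
          simp only [testTransform]
          rw [← integral_const_mul]
          refine integral_congr_ae (Eventually.of_forall fun z => ?_)
          simp only
          ring
  have hlim₁ : Tendsto (fun n => ∫ y, truncation ν V n y * testTransform e proj φ y ∂ν)
      atTop (𝓝 (∫ y, V y * testTransform e proj φ y ∂ν)) := by
    have hind : ∀ n y, truncation ν V n y * testTransform e proj φ y =
        (spanningSets ν n).indicator (fun y => V y * testTransform e proj φ y) y :=
      fun n y => by
      by_cases hy : y ∈ spanningSets ν n <;> simp [truncation, hy]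
    refine tendsto_integral_of_dominated_convergence
      (fun y => ‖V y * testTransform e proj φ y‖) (fun n => ?_) hVφ.norm
      (fun n => Eventually.of_forall fun y => ?_) (Eventually.of_forall fun y => ?_)
    · simp_rw [hind]
      exact hVφ.1.indicator (measurableSet_spanningSets ν n)
    · rw [hind]
      exact norm_indicator_le_norm_self _ _
    · refine tendsto_const_nhds.congr' ?_
      filter_upwards [tendsto_truncation (ν := ν) V y] with n hn
      rw [hn]
  have hlim₂ : Tendsto (fun n => ∫ z, oscIntegral e ν (truncation ν V n) (planeProj proj z) * φ z)
      atTop (𝓝 (∫ z, f (planeProj proj z) * φ z)) := by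
    obtain ⟨M, hM⟩ := hp.exists_lintegral_le φ
    refine tendsto_integral_of_L1 _ (hp.integrable_mul hf.1 φ).1
      (Eventually.of_forall fun n => hp.integrable_mul (hT n) φ) ?_
    have h0 : Tendsto (fun n => (M : ℝ≥0∞) *
        eLpNorm (oscIntegral e ν (truncation ν V n) - f) 2 volume) atTop (𝓝 0) := by
      simpa using ENNReal.Tendsto.const_mul hf.2 (Or.inr ENNReal.coe_ne_top)
    refine tendsto_of_tendsto_of_tendsto_of_le_of_le tendsto_const_nhds h0
      (fun _ => zero_le) fun n => ?_
    refine le_trans (le_of_eq (lintegral_congr fun z => ?_)) (hM _ ((hT n).sub hf.1).1)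
    rw [← sub_mul]
    rfl
  simp_rw [hswap] at hlim₂
  exact tendsto_nhds_unique hlim₂ hlim₁

end Cover

/-! ### The Fourier transform of distributions and the transform on `L²` -/

/-- Needed because the definition of û only tests u on functions of the form `fourierS φ`. -/
theorem fourierS_surjective : Function.Surjective fourierS := by
  intro ψ
  set e := WithLp.prodContinuousLinearEquiv 2 ℝ ℝ ℝ
  refine ⟨SchwartzMap.compCLMOfContinuousLinearEquiv ℂ e.symm
    (𝓕⁻ (SchwartzMap.compCLMOfContinuousLinearEquiv ℂ toPlane.symm ψ)), ?_⟩
  have h1 : SchwartzMap.compCLMOfContinuousLinearEquiv ℂ e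
      (SchwartzMap.compCLMOfContinuousLinearEquiv ℂ e.symm
        (𝓕⁻ (SchwartzMap.compCLMOfContinuousLinearEquiv ℂ toPlane.symm ψ))) =
      𝓕⁻ (SchwartzMap.compCLMOfContinuousLinearEquiv ℂ toPlane.symm ψ) := by
    ext x
    simp
  rw [fourierS, h1, FourierTransform.fourier_fourierInv_eq]
  ext x
  simp

/-- The inversion formula for `fourierS`. -/
theorem integral_lineChar_mul_fourierS (φ : 𝓢(ℝ × ℝ, ℂ)) (τ ξ : ℝ) :
    ∫ z : ℝ × ℝ, lineChar z.1 τ * lineChar z.2 ξ * fourierS φ z =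
      (2 * Real.pi) ^ 2 * φ (τ, ξ) := by
  have hpi := Real.two_pi_pos
  set φ' : 𝓢(WithLp 2 (ℝ × ℝ), ℂ) := SchwartzMap.compCLMOfContinuousLinearEquiv ℂ
    (WithLp.prodContinuousLinearEquiv 2 ℝ ℝ ℝ) φ with hφ'
  set g : ℝ × ℝ → ℂ := fun w =>
    Complex.exp (((2 * Real.pi * (w.1 * τ + w.2 * ξ) : ℝ) : ℂ) * Complex.I) *
      (𝓕 φ') (WithLp.toLp 2 w) with hg
  have h1 : ∀ z : ℝ × ℝ, lineChar z.1 τ * lineChar z.2 ξ * fourierS φ z =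
      g ((2 * Real.pi)⁻¹ • z) := fun z => by
    have e1 : fourierS φ z = (𝓕 φ') (WithLp.toLp 2 ((2 * Real.pi)⁻¹ • z)) := rfl
    simp only [hg, e1, lineChar]
    rw [← Complex.exp_add]
    congr 2
    have : (Real.pi : ℂ) ≠ 0 := by exact_mod_cast Real.pi_ne_zero
    simp only [Prod.smul_fst, Prod.smul_snd, smul_eq_mul]
    push_cast
    field_simp
  have h2 : ∫ w, g w = φ (τ, ξ) := by
    have e1 : ∫ w, g w = ∫ w : WithLp 2 (ℝ × ℝ), g (WithLp.ofLp w) :=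
      (((WithLp.volume_preserving_toLp (U := ℝ) (V := ℝ)).integral_comp
        (MeasurableEquiv.toLp 2 (ℝ × ℝ)).measurableEmbedding
          (fun w : WithLp 2 (ℝ × ℝ) => g (WithLp.ofLp w))))
    have e2 : φ (τ, ξ) = (𝓕⁻ (𝓕 φ')) (WithLp.toLp 2 (τ, ξ)) := by
      rw [FourierTransform.fourierInv_fourier_eq]; rfl
    rw [e1, e2, SchwartzMap.fourierInv_coe, Real.fourierInv_eq']
    refine integral_congr_ae (Eventually.of_forall fun w => ?_)
    simp only [hg, smul_eq_mul, WithLp.prod_inner_apply]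
    congr 2
    simp [mul_comm]
  simp_rw [h1]
  -- The factor (2π)² is the Jacobian of the dilation by (2π)⁻¹ in the plane.
  rw [Measure.integral_comp_smul, h2]
  simp only [Module.finrank_prod, Module.finrank_self, Complex.real_smul]
  rw [inv_pow, inv_inv, abs_of_pos (by positivity)]
  push_cast
  norm_num

/-- The space-time kernel. -/
def spaceTimeChar {A B : Type*} (e : A → B → ℂ) (x : ℝ × A) (y : ℝ × B) : ℂ := lineChar x.1 y.1 * e x.2 y.2

theorem testTransform_fourierS {A B : Type*} {e : A → B → ℂ} {proj : ℝ → A} {ι : B → ℝ}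
    (hproj : ∀ x b, e (proj x) b = lineChar x (ι b)) (φ : 𝓢(ℝ × ℝ, ℂ)) (y : ℝ × B) :
    testTransform (spaceTimeChar e) proj (fourierS φ) y =
      (2 * Real.pi) ^ 2 * φ (y.1, ι y.2) := by
  simp only [testTransform, spaceTimeChar, planeProj, hproj]
  exact integral_lineChar_mul_fourierS φ y.1 (ι y.2)

/-! ### The bilinear estimate for both settings at once -/

section Setting

variable {A B : Type*} [MeasureSpace A] [MeasurableSpace B] {β : Measure B}

/-- The space-time Fourier transform of `u` is the function `U`, for frequencies in the image
of `ι : B → ℝ`. -/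
def HasFourier (ι : B → ℝ) (β : Measure B) (u : 𝓢'(ℝ × ℝ, ℂ)) (U : ℝ × B → ℂ) : Prop :=
  AEStronglyMeasurable U ((volume : Measure ℝ).prod β) ∧
    ∀ φ : 𝓢(ℝ × ℝ, ℂ),
      Integrable (fun p : ℝ × B => U p * φ (p.1, ι p.2)) ((volume : Measure ℝ).prod β) ∧
      u (fourierS φ) = ∫ p : ℝ × B, U p * φ (p.1, ι p.2) ∂((volume : Measure ℝ).prod β)

/-- The distribution `u` is the lift of the square integrable function `f`. -/
def IsFun (proj : ℝ → A) (u : 𝓢'(ℝ × ℝ, ℂ)) (f : ℝ × A → ℂ) : Prop :=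
  MemLp f 2 volume ∧ ∀ φ : 𝓢(ℝ × ℝ, ℂ), u φ = ∫ z, f (planeProj proj z) * φ z

/-- The function `U`, normalized for Fourier inversion. -/
def inversionDensity (U : ℝ × B → ℂ) : ℝ × B → ℂ := fun y => (((2 * Real.pi) ^ 2 : ℝ) : ℂ)⁻¹ * U y

/-- The function is the transform of (2π)⁻² U. In the pairing with `fourierS φ` the transform moves
to the test function, where inversion returns (2π)² φ. -/
theorem HasFourier.exists_isFun [SFinite (volume : Measure A)] [SigmaFinite β] {e : A → B → ℂ}
    {proj : ℝ → A} {ι : B → ℝ} {C : ℝ≥0} (hp : IsCover proj) (he : IsBesselKernel e volume β C)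
    (hproj : ∀ x b, e (proj x) b = lineChar x (ι b)) {u : 𝓢'(ℝ × ℝ, ℂ)} {U : ℝ × B → ℂ}
    (hu : HasFourier ι β u U) (hU : MemLp U 2 ((volume : Measure ℝ).prod β)) :
    ∃ f, IsFun proj u f ∧ IsL2Transform (spaceTimeChar e) volume ((volume : Measure ℝ).prod β)
      (inversionDensity U) f := by
  have hK : IsBesselKernel (spaceTimeChar e) (volume : Measure (ℝ × A))
    ((volume : Measure ℝ).prod β) _ := isBesselKernel_lineChar.prod he
  have hV : MemLp (inversionDensity U) 2 ((volume : Measure ℝ).prod β) := hU.const_mul _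
  obtain ⟨f, hf⟩ := hK.exists_isL2Transform hV
  refine ⟨f, ⟨hf.1, fun ψ => ?_⟩, hf⟩
  obtain ⟨φ, rfl⟩ := fourierS_surjective ψ
  have hpi : ((2 * Real.pi : ℝ) : ℂ) ^ 2 ≠ 0 := by
    exact_mod_cast (pow_pos Real.two_pi_pos 2).ne'
  have hmul : ∀ y, inversionDensity U y * testTransform (spaceTimeChar e) proj (fourierS φ) y =
      U y * φ (y.1, ι y.2) := fun y => by
    rw [testTransform_fourierS hproj, inversionDensity]
    push_cast at hpi ⊢
    field_simp
  rw [hf.integral_mul hK hp hV (fourierS φ) (by simp_rw [hmul]; exact (hu.2 φ).1)]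
  simp_rw [hmul]
  exact (hu.2 φ).2

theorem one_le_weight {α s b : ℝ} (hs : 0 ≤ s) (hb : 0 ≤ b) (τ ξ : ℝ) : 1 ≤ weight α s b τ ξ :=
  one_le_mul_of_one_le_of_one_le (Real.one_le_rpow (one_le_bracket _) hs)
    (Real.one_le_rpow (one_le_bracket _) hb)

theorem memLp_of_eLpNorm_weight_lt_top {α s b : ℝ} (hs : 0 ≤ s) (hb : 0 ≤ b) {ι : B → ℝ}
    {U : ℝ × B → ℂ} (hU : AEStronglyMeasurable U ((volume : Measure ℝ).prod β))
    (h : eLpNorm (fun p => (weight α s b p.1 (ι p.2) : ℂ) * U p) 2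
      ((volume : Measure ℝ).prod β) < ∞) : MemLp U 2 ((volume : Measure ℝ).prod β) := by
  refine ⟨hU, (eLpNorm_mono fun p => ?_).trans_lt h⟩
  have h1 := one_le_weight (α := α) hs hb p.1 (ι p.2)
  rw [norm_mul, Complex.norm_real, Real.norm_of_nonneg (by linarith)]
  exact le_mul_of_one_le_left (norm_nonneg _) h1

/-- The bilinear estimate in both settings, in terms of given Fourier transforms. -/
theorem exists_bilinear_estimate [SFinite (volume : Measure A)] [SigmaFinite β]
    [AddCommGroup B] [MeasurableAdd₂ B] [MeasurableSub₂ B] [MeasurableNeg B] [β.IsAddLeftInvariant]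
    {e : A → B → ℂ} {proj : ℝ → A} {ι : B →+ ℝ} {C : ℝ≥0} (hp : IsCover proj)
    (he : IsBesselKernel e volume β C) (hadd : ∀ x y y', e x (y + y') = e x y * e x y')
    (hproj : ∀ x b, e (proj x) b = lineChar x (ι b)) (hι : Measurable ι)
    (hβ : BracketBound (β.map ι)) {α ε s : ℝ} (hα₁ : 1 < α) (hα₂ : α < 2)
    (hs : (2 - α) / 4 ≤ s) (hε : 0 < ε) (hε₁ : ε < (2 - α) / 4) (hε₂ : ε < (α - 1) / 4) :
    ∃ K : ℝ≥0, ∀ (u v : 𝓢'(ℝ × ℝ, ℂ)) (U V : ℝ × B → ℂ), HasFourier ι β u U →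
      HasFourier ι β v V →
      eLpNorm (fun p => (weight α 0 (1 / 2 - ε) p.1 (ι p.2) : ℂ) * U p) 2
        ((volume : Measure ℝ).prod β) < ∞ →
      eLpNorm (fun p => (weight α s (1 / 2 + ε) p.1 (ι p.2) : ℂ) * V p) 2
        ((volume : Measure ℝ).prod β) < ∞ →
      ((∃ f, IsFun proj u f) ∧ (∃ g, IsFun proj v g)) ∧
      ∀ f g, IsFun proj u f → IsFun proj v g →
        eLpNorm (fun p => f p * g p) 2 volume ≤
          K * eLpNorm (fun p => (weight α 0 (1 / 2 - ε) p.1 (ι p.2) : ℂ) * U p) 2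
            ((volume : Measure ℝ).prod β) *
          eLpNorm (fun p => (weight α s (1 / 2 + ε) p.1 (ι p.2) : ℂ) * V p) 2
            ((volume : Measure ℝ).prod β) := by
  set ν := (volume : Measure ℝ).prod β
  have hK : IsBesselKernel (spaceTimeChar e) (volume : Measure (ℝ × A)) ν _ :=
    isBesselKernel_lineChar.prod he
  obtain ⟨K, hKz⟩ := exists_lintegral_weight_le hι hβ hα₁ hα₂ hs hε hε₁ hε₂
  set c : ℂ := (((2 * Real.pi) ^ 2 : ℝ) : ℂ)⁻¹
  -- The root holds the Bessel constant of the space-time kernel times K; each density contributes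
  -- one factor |c| = (2π)⁻².
  refine ⟨NNReal.sqrt ((2 * Real.pi).toNNReal * C * K) * (‖c‖₊ * ‖c‖₊),
    fun u v U V hu hv hUfin hVfin => ?_⟩
  have hs0 : 0 ≤ s := by linarith
  have hU := memLp_of_eLpNorm_weight_lt_top (α := α) le_rfl (by linarith) hu.1 hUfin
  have hV := memLp_of_eLpNorm_weight_lt_top (α := α) hs0 (by linarith) hv.1 hVfin
  obtain ⟨f₀, hf₀, hf₀'⟩ := hu.exists_isFun hp he hproj hU
  obtain ⟨g₀, hg₀, hg₀'⟩ := hv.exists_isFun hp he hproj hV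
  refine ⟨⟨⟨f₀, hf₀⟩, ⟨g₀, hg₀⟩⟩, fun f g hf hg => ?_⟩
  have hff : f =ᵐ[volume] f₀ := hp.ae_eq_of_forall_integral_eq hf.1 hf₀.1
    fun φ => (hf.2 φ).symm.trans (hf₀.2 φ)
  have hgg : g =ᵐ[volume] g₀ := hp.ae_eq_of_forall_integral_eq hg.1 hg₀.1
    fun φ => (hg.2 φ).symm.trans (hg₀.2 φ)
  have hwm : ∀ s b : ℝ, Measurable fun y : ℝ × B => weight α s b y.1 (ι y.2) := fun s b => by
    unfold weight; fun_prop
  have hscale : ∀ (s b : ℝ) (W : ℝ × B → ℂ),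
      (fun y : ℝ × B => (weight α s b y.1 (ι y.2) : ℂ) * inversionDensity W y) =
        c • fun y => (weight α s b y.1 (ι y.2) : ℂ) * W y := fun s b W => by
    funext y
    simp only [inversionDensity, Pi.smul_apply, smul_eq_mul, c]
    ring
  have hmem : ∀ (s b : ℝ) (W : ℝ × B → ℂ), AEStronglyMeasurable W ν →
      eLpNorm (fun p => (weight α s b p.1 (ι p.2) : ℂ) * W p) 2 ν < ∞ →
      MemLp (fun y : ℝ × B => (weight α s b y.1 (ι y.2) : ℂ) * inversionDensity W y) 2 ν :=
    fun s b W hW hfin => by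
    rw [hscale]
    refine MemLp.const_smul ⟨?_, hfin⟩ c
    exact (Complex.measurable_ofReal.comp (hwm s b)).aestronglyMeasurable.mul hW
  have : MeasurableAdd₂ (ℝ × B) :=
    ⟨((measurable_fst.comp measurable_fst).add (measurable_fst.comp measurable_snd)).prodMk
      ((measurable_snd.comp measurable_fst).add (measurable_snd.comp measurable_snd))⟩
  have : MeasurableNeg (ℝ × B) := ⟨measurable_fst.neg.prodMk measurable_snd.neg⟩
  have : MeasurableSub₂ (ℝ × B) :=
    ⟨((measurable_fst.comp measurable_fst).sub (measurable_fst.comp measurable_snd)).prodMk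
      ((measurable_snd.comp measurable_fst).sub (measurable_snd.comp measurable_snd))⟩
  have main := hK.eLpNorm_mul_le (fun x y y' => by
      simp only [spaceTimeChar, Prod.fst_add, Prod.snd_add, lineChar_add, hadd]; ring)
    (V := inversionDensity U) (W := inversionDensity V)
    (a := fun y => weight α 0 (1 / 2 - ε) y.1 (ι y.2))
    (b := fun y => weight α s (1 / 2 + ε) y.1 (ι y.2)) (hwm _ _) (hwm _ _)
    (fun y => zero_lt_one.trans_le (one_le_weight le_rfl (by linarith) _ _))
    (fun y => zero_lt_one.trans_le (one_le_weight hs0 (by linarith) _ _)) hKz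
    (hU.const_mul _) (hV.const_mul _) (hmem _ _ U hu.1 hUfin) (hmem _ _ V hv.1 hVfin) hf₀' hg₀'
  rw [hscale, hscale, eLpNorm_const_smul, eLpNorm_const_smul] at main
  refine (eLpNorm_congr_ae (hff.mul hgg)).trans_le (main.trans (le_of_eq ?_))
  rw [enorm_eq_nnnorm]
  push_cast
  ring

end Setting

/-- A bilinear bound by the values of two functions passes to their infima, if these are finite. -/
theorem le_mul_iInf_mul_iInf {X : Type*} {P Q : X → Prop} {n m : X → ℝ≥0∞} {x : ℝ≥0∞} {C : ℝ≥0}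
    (hn : ⨅ (U : X) (_ : P U), n U < ∞) (hm : ⨅ (V : X) (_ : Q V), m V < ∞)
    (h : ∀ U V, P U → Q V → n U < ∞ → m V < ∞ → x ≤ C * n U * m V) :
    x ≤ C * (⨅ (U : X) (_ : P U), n U) * ⨅ (V : X) (_ : Q V), m V := by
  have hex : ∀ {P : X → Prop} {n : X → ℝ≥0∞} {I : ℝ≥0} {δ : ℝ≥0},
      (I : ℝ≥0∞) = ⨅ (U : X) (_ : P U), n U → 0 < δ → ∃ U, P U ∧ n U < (I + δ : ℝ≥0) := by
    intro P n I δ hI hδ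
    have h1 : ⨅ (U : X) (_ : P U), n U < (I + δ : ℝ≥0) := by
      rw [← hI]
      exact_mod_cast lt_add_of_pos_right I hδ
    obtain ⟨U, hU⟩ := iInf_lt_iff.1 h1
    obtain ⟨hP, hU⟩ := iInf_lt_iff.1 hU
    exact ⟨U, hP, hU⟩
  obtain ⟨I, hI⟩ := WithTop.ne_top_iff_exists.1 hn.ne
  obtain ⟨J, hJ⟩ := WithTop.ne_top_iff_exists.1 hm.ne
  rw [← hI, ← hJ]
  -- The infima are approached within δ; with finite values the product is continuous in δ.
  have hlim : Tendsto (fun δ : ℝ≥0 => ((C * (I + δ) * (J + δ) : ℝ≥0) : ℝ≥0∞)) (𝓝[>] 0)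
      (𝓝 ((C * (I + 0) * (J + 0) : ℝ≥0) : ℝ≥0∞)) := by
    refine (Continuous.tendsto ?_ 0).mono_left nhdsWithin_le_nhds
    exact ENNReal.continuous_coe.comp (by fun_prop)
  rw [add_zero, add_zero, ENNReal.coe_mul, ENNReal.coe_mul] at hlim
  refine ge_of_tendsto hlim (eventually_mem_nhdsWithin.mono fun δ hδ => ?_)
  obtain ⟨U, hU, hUn⟩ := hex hI hδ
  obtain ⟨V, hV, hVm⟩ := hex hJ hδ
  refine (h U V hU hV (hUn.trans ENNReal.coe_lt_top) (hVm.trans ENNReal.coe_lt_top)).trans ?_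
  push_cast at hUn hVm ⊢
  gcongr

theorem eLpNorm_mul_conj {X : Type*} [MeasurableSpace X] (μ : Measure X) (f g : X → ℂ) :
    eLpNorm (fun p => f p * g p) 2 μ = eLpNorm (fun p => f p * conj (g p)) 2 μ :=
  eLpNorm_congr_norm_ae (Eventually.of_forall fun p => by simp)

end FracNLS

end

/-! ### The theorem, by specialization to the line and the circle -/

theorem proposition3p2 (α : ℝ) (hα₁ : 1 < α) (hα₂ : α < 2) :
    ∃ ε₀ : ℝ, 0 < ε₀ ∧ ∀ ε : ℝ, 0 < ε → ε < ε₀ → ∀ s : ℝ, (2 - α) / 4 ≤ s →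
      -- the non-periodic setting
      (∃ C : ℝ≥0,
        ∀ u ∈ FracNLS.XLine α 0 (1 / 2 - ε), ∀ v ∈ FracNLS.XLine α s (1 / 2 + ε),
          (∃ f, FracNLS.IsFunLine u f) ∧ (∃ g, FracNLS.IsFunLine v g) ∧
          ∀ f g : ℝ × ℝ → ℂ, FracNLS.IsFunLine u f → FracNLS.IsFunLine v g →
            eLpNorm (fun p => f p * g p) 2 volume =
              eLpNorm (fun p => f p * conj (g p)) 2 volume ∧
            eLpNorm (fun p => f p * g p) 2 volume ≤
              C * FracNLS.normXLine α 0 (1 / 2 - ε) u * FracNLS.normXLine α s (1 / 2 + ε) v) ∧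
      -- the periodic setting
      (∃ C : ℝ≥0,
        ∀ u ∈ FracNLS.XTorus α 0 (1 / 2 - ε), ∀ v ∈ FracNLS.XTorus α s (1 / 2 + ε),
          (∃ f, FracNLS.IsFunTorus u f) ∧ (∃ g, FracNLS.IsFunTorus v g) ∧
          ∀ f g : ℝ × FracNLS.Circ → ℂ, FracNLS.IsFunTorus u f → FracNLS.IsFunTorus v g →
            eLpNorm (fun p => f p * g p) 2 volume =
              eLpNorm (fun p => f p * conj (g p)) 2 volume ∧
            eLpNorm (fun p => f p * g p) 2 volume ≤
              C * FracNLS.normXTorus α 0 (1 / 2 - ε) u *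
                FracNLS.normXTorus α s (1 / 2 + ε) v) := by
  -- With p = 1 - 2ε, the first bound serves integrability near frequency zero, the second the far
  -- region.
  refine ⟨min ((2 - α) / 4) ((α - 1) / 4), lt_min (by linarith) (by linarith),
    fun ε hε hε₀ s hs => ?_⟩
  have hε₁ := hε₀.trans_le (min_le_left _ _)
  have hε₂ := hε₀.trans_le (min_le_right _ _)
  have hattained : ∀ {X : Type} {P : X → Prop} {n : X → ℝ≥0∞},
      ⨅ (U : X) (_ : P U), n U < ∞ → ∃ U, P U ∧ n U < ∞ := fun h => by
    obtain ⟨U, hU⟩ := iInf_lt_iff.1 h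
    obtain ⟨hP, hU⟩ := iInf_lt_iff.1 hU
    exact ⟨U, hP, hU⟩
  constructor
  · obtain ⟨K, hK⟩ := FracNLS.exists_bilinear_estimate (ι := AddMonoidHom.id ℝ) FracNLS.isCover_id
      FracNLS.isBesselKernel_lineChar FracNLS.lineChar_add (fun _ _ => rfl) measurable_id
      (by rw [AddMonoidHom.coe_id, Measure.map_id]; exact FracNLS.bracketBound_volume)
      hα₁ hα₂ hs hε hε₁ hε₂
    refine ⟨K, fun u hu v hv => ?_⟩
    obtain ⟨U, hU, hUfin⟩ := hattained hu
    obtain ⟨V, hV, hVfin⟩ := hattained hv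
    obtain ⟨⟨hf, hg⟩, -⟩ := hK u v U V hU hV hUfin hVfin
    refine ⟨hf, hg, fun f g hf hg => ⟨FracNLS.eLpNorm_mul_conj _ f g, ?_⟩⟩
    exact FracNLS.le_mul_iInf_mul_iInf hu hv fun U V hU hV hUfin hVfin =>
      (hK u v U V hU hV hUfin hVfin).2 f g hf hg
  · obtain ⟨K, hK⟩ := FracNLS.exists_bilinear_estimate (ι := Int.castAddHom ℝ) FracNLS.isCover_circ
      FracNLS.isBesselKernel_circChar FracNLS.circChar_add FracNLS.circChar_coe
      measurable_from_top FracNLS.bracketBound_count_int hα₁ hα₂ hs hε hε₁ hε₂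
    refine ⟨K, fun u hu v hv => ?_⟩
    obtain ⟨U, hU, hUfin⟩ := hattained hu.2
    obtain ⟨V, hV, hVfin⟩ := hattained hv.2
    obtain ⟨⟨hf, hg⟩, -⟩ := hK u v U V hU hV hUfin hVfin
    refine ⟨hf, hg, fun f g hf hg => ⟨FracNLS.eLpNorm_mul_conj _ f g, ?_⟩⟩
    exact FracNLS.le_mul_iInf_mul_iInf hu.2 hv.2 fun U V hU hV hUfin hVfin =>
      (hK u v U V hU hV hUfin hVfin).2 f g hf hg
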